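/- Let $d\ge 1$, let $|\cdot|$ denote the $1$-norm on $\mathbb Z^d$, and for $L\ge 1$ let $\Lambda_L=[-L,L]^d\cap\mathbb Z^d$. Let the masses $m_x$, the spring constants $k_x$ ($x\in\mathbb Z^d$) and the couplings $\lambda_{x,y}=\lambda_{y,x}$ ($|x-y|=1$) be real random variables on a probability space $(\Omega,\mathbb P)$ such that, with deterministic constants $m_{\min},m_{\max},k_{\max},\lambda_{\max}$, almost surely $$0<m_{\min}\le m_x\le m_{\max},\qquad 0\le k_x\le k_{\max},\qquad 0\le\lambda_{x,y}\le\lambda_{\max}$$ for all sites and all nearest-neighbour pairs. Let $$H_L=\sum_{x\in\Lambda_L}\Big(\frac{1}{2m_x}p_x^2+\frac{k_x}{2}q_x^2\Big)+\sum_{\{x,y\}\subset\Lambda_L,\ |x-y|=1}\lambda_{x,y}(q_x-q_y)^2$$ be the self-adjoint operator on $L^2(\mathbb R^{\Lambda_L})$ obtained as closure from the Schwartz functions, where $q_x$ is multiplication by the coordinate $q_x$ and $p_x=-i\,\partial/\partial q_x$. Let $\tau_t(A)=e^{itH_L}Ae^{-itH_L}$ for bounded operators $A$, and for $f:\Lambda_L\to\mathbb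 C$ let $W(f)=\exp\big[i\sum_{x\in\Lambda_L}(\mathrm{Re}f(x)\,q_x+\mathrm{Im}f(x)\,p_x)\big]$ be the Weyl operator. Let $h_{0,L}$ be the real symmetric matrix on $\ell^2(\Lambda_L)$ with diagonal entries $\frac{k_x}{2}+\sum_{u\in\Lambda_L:|u-x|=1}\lambda_{x,u}$, entries $-\lambda_{x,y}$ for $|x-y|=1$, and all other entries $0$; assume that almost surely $h_{0,L}$ is positive definite for all $L\ge1$. Let $h_L=\mu^{1/2}h_{0,L}\mu^{1/2}$, where $\mu$ is the diagonal matrix with entries $\frac1{2m_x}$. Let $r\in(0,1]$ and assume that $h_L$ has exponentially decaying $(-1/2,r)$-eigenfunction correlators, i.e. there exist $C<\infty$ and $\eta>0$ such that $$\mathbb E\Big(\sup_{|u|\le1}\big|\langle\delta_x,h_L^{-1/2}u(h_L)\delta_y\rangle\big|^r\Big)\le Ce^{-\eta|x-y|}$$ for all integers $L\ge1$ and all $x,y\in\Lambda_L$, where the supremum is over all functions $u:\mathbb R\to\mathbb C$ with $|u|\le1$ pointwise. Then there exist $C'<\infty$ and $\mu'>0$ such that $$\mathbb E\Big(\sup_{t\in\mathbb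 R}\big\|[\tau_t(W(f)),W(g)]\big\|\Big)\le C'\sum_{x,y\in\Lambda_L}|f(x)|^r|g(y)|^re^{-\mu'|x-y|}$$ for all $L\ge1$ and all $f,g:\Lambda_L\to\mathbb C$. -/

import Mathlib

open MeasureTheory
open scoped SchwartzMap LineDeriv ENNReal

noncomputable section

namespace OscillatorSystem

/-! ### One-parameter unitary groups -/

section UnitaryGroup

variable {E : Type*} [NormedAddCommGroup E] [InnerProductSpace ℂ E] [CompleteSpace E]

/-- `U` is the strongly continuous one-parameter unitary group with (Stone) generator `A`, that is,
`U t = exp (i t A)`. The last field says that the domain of `A` is exactly the set of `ψ` for which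
`t ↦ U t ψ` is differentiable at `0`, and that the derivative is then `i A ψ`. -/
structure IsUnitaryGroupOf (A : E →ₗ.[ℂ] E) (U : ℝ → E →L[ℂ] E) : Prop where
  unitary_mem : ∀ t, U t ∈ unitary (E →L[ℂ] E)
  map_zero : U 0 = 1
  map_add : ∀ s t, U (s + t) = U s * U t
  continuous_apply : ∀ ψ, Continuous fun t => U t ψ
  mem_graph_iff : ∀ ψ χ, (ψ, χ) ∈ A.graph ↔ HasDerivAt (fun t => U t ψ) (Complex.I • χ) 0

open Classical in
/-- `expI A t = exp (i t A)` for a self-adjoint operator `A`: by Stone's theorem there is exactly one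
unitary group with generator `A`. (If `A` is not self-adjoint there is none, and the value is the
identity by convention; this does not occur for the operators used below.) -/
def expI (A : E →ₗ.[ℂ] E) (t : ℝ) : E →L[ℂ] E :=
  if h : ∃ U : ℝ → E →L[ℂ] E, IsUnitaryGroupOf A U then h.choose t else 1

end UnitaryGroup

/-! ### The lattice, the boxes and the parameters -/

/-- The lattice `ℤ^d`. -/
abbrev Site (d : ℕ) : Type := Fin d → ℤ

/-- The distance `|x - y|` in the `1`-norm. -/
def siteDist {d : ℕ} (x y : Site d) : ℕ := ∑ i, (x i - y i).natAbs

theorem siteDist_comm {d : ℕ} (x y : Site d) : siteDist x y = siteDist y x := by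
  unfold siteDist
  exact Finset.sum_congr rfl fun i _ => by omega

/-- The cube `Λ_L = [-L, L]^d ∩ ℤ^d`. -/
abbrev Box (d L : ℕ) : Type :=
  ↥(Finset.Icc (fun _ : Fin d => -(L : ℤ)) (fun _ : Fin d => (L : ℤ)))

/-- A (deterministic) choice of masses `m_x`, spring constants `k_x` and couplings `λ_{x,y}`, the
latter indexed by unordered pairs; only the couplings of nearest neighbours are ever used. -/
structure Params (d : ℕ) where
  m : Site d → ℝ
  k : Site d → ℝ
  lam : Sym2 (Site d) → ℝ

/-- The parameters satisfy the uniform bounds with the given constants. -/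
structure Params.Bounds {d : ℕ} (p : Params d) (mMin mMax kMax lamMax : ℝ) : Prop where
  mMin_pos : 0 < mMin
  m_mem : ∀ x, p.m x ∈ Set.Icc mMin mMax
  k_mem : ∀ x, p.k x ∈ Set.Icc 0 kMax
  lam_mem : ∀ x y, siteDist x y = 1 → p.lam s(x, y) ∈ Set.Icc 0 lamMax

variable {d : ℕ}

/-! ### The one-particle operators -/

/-- The matrix `h_{0,L}` on `ℓ²(Λ_L)`. -/
def h0 (p : Params d) (L : ℕ) : Matrix (Box d L) (Box d L) ℝ :=
  Matrix.of fun x y =>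
    if x = y then
      p.k x / 2 + ∑ u : Box d L, if siteDist (x : Site d) u = 1 then p.lam s(↑x, ↑u) else 0
    else if siteDist (x : Site d) y = 1 then -p.lam s(↑x, ↑y)
    else 0

/-- The diagonal matrix `μ^{1/2}`, where `μ` has the diagonal entries `1 / (2 m_x)`. -/
def sqrtMu (p : Params d) (L : ℕ) : Matrix (Box d L) (Box d L) ℝ :=
  Matrix.diagonal fun x => Real.sqrt (1 / (2 * p.m x))

/-- The effective one-particle operator `h_L = μ^{1/2} h_{0,L} μ^{1/2}`. -/
def hL (p : Params d) (L : ℕ) : Matrix (Box d L) (Box d L) ℝ :=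
  sqrtMu p L * h0 p L * sqrtMu p L

theorem h0_isHermitian (p : Params d) (L : ℕ) : (h0 p L).IsHermitian := by
  ext x y
  simp only [h0, Matrix.conjTranspose_apply, Matrix.of_apply, star_trivial]
  by_cases h : x = y
  · subst h; rfl
  · rw [if_neg h, if_neg (Ne.symm h), siteDist_comm, Sym2.eq_swap]

theorem hL_isHermitian (p : Params d) (L : ℕ) : (hL p L).IsHermitian := by
  have hD : (sqrtMu p L).conjTranspose = sqrtMu p L := by
    simp [sqrtMu]
  have h0' : (h0 p L).conjTranspose = h0 p L := h0_isHermitian p L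
  simp only [Matrix.IsHermitian, hL, Matrix.conjTranspose_mul, hD, h0', Matrix.mul_assoc]

/-- The functional calculus of a real symmetric matrix, as an eigenfunction expansion: the matrix
element `⟨δ_x, φ(A) δ_y⟩ = ∑_k φ(E_k) v_k(x) v_k(y)`. -/
def matFun {n : Type*} [Fintype n] [DecidableEq n] {A : Matrix n n ℝ} (hA : A.IsHermitian)
    (φ : ℝ → ℂ) : Matrix n n ℂ :=
  Matrix.of fun x y =>
    ∑ j, φ (hA.eigenvalues j) * (hA.eigenvectorBasis j x : ℂ) * (hA.eigenvectorBasis j y : ℂ)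

/-- `sup_{|u| ≤ 1} |⟨δ_x, h_L^α u(h_L) δ_y⟩|^r`, over all functions `u : ℝ → ℂ` with `|u| ≤ 1`. -/
def eigenCorrelator (α r : ℝ) (p : Params d) (L : ℕ) (x y : Box d L) : ℝ≥0∞ :=
  ⨆ (u : ℝ → ℂ) (_ : ∀ s, ‖u s‖ ≤ 1),
    ‖matFun (hL_isHermitian p L) (fun s => ((s ^ α : ℝ) : ℂ) * u s) x y‖ₑ ^ r

/-- For random parameters `p`, the operators `h_L` have exponentially decaying
`(α, r)`-eigenfunction correlators. -/
def ExpDecayingCorrelators {Ω : Type*} [MeasurableSpace Ω] (P : Measure Ω) (p : Ω → Params d)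
    (α r : ℝ) : Prop :=
  ∃ C μ : ℝ, 0 < μ ∧ ∀ L : ℕ, 1 ≤ L → ∀ x y : Box d L,
    ∫⁻ ω, eigenCorrelator α r (p ω) L x y ∂P
      ≤ ENNReal.ofReal (C * Real.exp (-μ * siteDist (x : Site d) y))

/-! ### The many-body operators -/

/-- Configuration space `ℝ^{Λ_L}`. -/
abbrev Config (d L : ℕ) : Type := EuclideanSpace ℝ (Box d L)

/-- The Hilbert space `L²(ℝ^{Λ_L})`. -/
abbrev HilbertL (d L : ℕ) : Type := Lp ℂ 2 (volume : Measure (Config d L))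

/-- The position operator `q_x` on Schwartz functions: multiplication by the coordinate `q_x`. -/
def posOp {L : ℕ} (x : Box d L) : Module.End ℂ 𝓢(Config d L, ℂ) :=
  (SchwartzMap.smulLeftCLM ℂ fun q : Config d L => ((q x : ℝ) : ℂ)).toLinearMap

/-- The momentum operator `p_x = -i ∂/∂q_x` on Schwartz functions. -/
def momOp {L : ℕ} (x : Box d L) : Module.End ℂ 𝓢(Config d L, ℂ) :=
  (-Complex.I) •
    (LineDeriv.lineDerivOpCLM ℂ 𝓢(Config d L, ℂ) (EuclideanSpace.single x (1 : ℝ))).toLinearMap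

theorem posOp_apply {L : ℕ} (x : Box d L) (φ : 𝓢(Config d L, ℂ)) (q : Config d L) :
    posOp x φ q = (q x : ℂ) * φ q := by
  have hg : (fun q : Config d L => ((q x : ℝ) : ℂ)).HasTemperateGrowth :=
    ((Complex.ofRealCLM.comp (EuclideanSpace.proj x : Config d L →L[ℝ] ℝ))).hasTemperateGrowth
  exact SchwartzMap.smulLeftCLM_apply_apply hg φ q

theorem momOp_apply {L : ℕ} (x : Box d L) (φ : 𝓢(Config d L, ℂ)) (q : Config d L) :
    momOp x φ q = -Complex.I * lineDeriv ℝ φ q (EuclideanSpace.single x 1) := by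
  simp [momOp, SchwartzMap.lineDerivOp_apply]

/-- The operator on `L²` whose domain is the Schwartz space and which acts there as `T`. -/
def schwartzPMap {L : ℕ} (T : Module.End ℂ 𝓢(Config d L, ℂ)) :
    HilbertL d L →ₗ.[ℂ] HilbertL d L where
  domain := LinearMap.range (SchwartzMap.toLpCLM ℂ ℂ 2 (volume : Measure (Config d L))).toLinearMap
  toFun :=
    (SchwartzMap.toLpCLM ℂ ℂ 2 (volume : Measure (Config d L))).toLinearMap ∘ₗ T ∘ₗ
      (LinearEquiv.ofInjective
        (SchwartzMap.toLpCLM ℂ ℂ 2 (volume : Measure (Config d L))).toLinearMap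
        (SchwartzMap.injective_toLp 2 (volume : Measure (Config d L)))).symm.toLinearMap

/-- The Hamiltonian
`∑_x (p_x² / (2 m_x) + (k_x / 2) q_x²) + ∑_{{x,y}, |x-y|=1} λ_{x,y} (q_x - q_y)²`
on Schwartz functions; the second sum runs over unordered pairs. -/
def hamiltonianOp (p : Params d) (L : ℕ) : Module.End ℂ 𝓢(Config d L, ℂ) :=
  ∑ x : Box d L,
      (((1 / (2 * p.m x) : ℝ) : ℂ) • momOp x ^ 2 + ((p.k x / 2 : ℝ) : ℂ) • posOp x ^ 2) +
    ∑ e : Sym2 (Box d L),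
      Sym2.lift ⟨fun x y : Box d L =>
        if siteDist (x : Site d) y = 1 then
          ((p.lam s(↑x, ↑y) : ℝ) : ℂ) • (posOp x - posOp y) ^ 2
        else 0, fun x y => by
          beta_reduce
          rw [siteDist_comm, Sym2.eq_swap, ← neg_sub (posOp y) (posOp x), neg_sq]⟩ e

/-- The self-adjoint Hamiltonian `H_L`: the closure of the Hamiltonian on Schwartz functions. -/
def hamiltonian (p : Params d) (L : ℕ) : HilbertL d L →ₗ.[ℂ] HilbertL d L :=
  (schwartzPMap (hamiltonianOp p L)).closure

/-- The Heisenberg dynamics `τ_t(A) = exp(i t H_L) A exp(-i t H_L)`. -/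
def heisenberg (p : Params d) (L : ℕ) (t : ℝ) (A : HilbertL d L →L[ℂ] HilbertL d L) :
    HilbertL d L →L[ℂ] HilbertL d L :=
  expI (hamiltonian p L) t * A * expI (hamiltonian p L) (-t)

/-- The self-adjoint operator `∑_x (Re f(x) q_x + Im f(x) p_x)`, as a closure from Schwartz
functions. -/
def fieldOp {L : ℕ} (f : Box d L → ℂ) : HilbertL d L →ₗ.[ℂ] HilbertL d L :=
  (schwartzPMap (∑ x, (((f x).re : ℂ) • posOp x + ((f x).im : ℂ) • momOp x))).closure

/-- The Weyl operator `W(f) = exp (i ∑_x (Re f(x) q_x + Im f(x) p_x))`. -/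
def weyl {L : ℕ} (f : Box d L → ℂ) : HilbertL d L →L[ℂ] HilbertL d L :=
  expI (fieldOp f) 1

end OscillatorSystem

end

open OscillatorSystem

/-!
The Hamiltonian `H_L` is quadratic and positive definite, so in normal coordinates it is a sum of
harmonic oscillators. Applying raising operators to the Gaussian ground state gives a complete
system of eigenfunctions, and from them the unitary group generated by the closure of `H_L`.
Differentiating along the classical flow shows that `τ_t` maps the Weyl operator of a phase space
point to the Weyl operator of the evolved point. By the canonical commutation relations
`‖[τ_t(W(f)), W(g)]‖ ≤ |exp (i σ) - 1| ≤ 2 |σ|^r`, where `σ` is the symplectic form of the evolved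
`f` with `g`. This form is a sum over pairs of sites of matrix elements of `cos (2 t √h_L)`,
`h_L^{-1/2} sin (2 t √h_L)` and `h_L^{1/2} sin (2 t √h_L)`. The spectrum of `h_L` is bounded
uniformly in `L`, so each of these operators is `h_L^{-1/2} u(h_L)` for a function `u` bounded
uniformly in `t` and `L`, and is controlled by the eigenfunction correlators;
`(a + b)^r ≤ a^r + b^r` lets the contributions be summed.
-/

noncomputable section

namespace OscillatorSystem

open Filter Topology
open scoped InnerProductSpace

/-! ### Strongly continuous unitary groups and their generators -/

section UnitaryGroups

theorem eq_zero_of_hasDerivAt_self_of_norm_le {F : Type*} [NormedAddCommGroup F] [NormedSpace ℝ F]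
    {g : ℝ → F} {C : ℝ} (hg : ∀ t, HasDerivAt g (g t) t) (hC : ∀ t, ‖g t‖ ≤ C) (t : ℝ) :
    g t = 0 := by
  have hexp (s : ℝ) : g (t + s) = Real.exp s • g t := by
    have hd (s : ℝ) : HasDerivAt (fun s => Real.exp (-s) • g (t + s)) 0 s := by
      refine (((hasDerivAt_neg s).exp).smul ((hg (t + s)).comp_const_add t s)).congr_deriv ?_
      rw [mul_neg_one, neg_smul, add_neg_cancel]
    have hconst := is_const_of_deriv_eq_zero (fun s => (hd s).differentiableAt)
      (fun s => (hd s).deriv) s 0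
    rw [neg_zero, Real.exp_zero, one_smul, add_zero] at hconst
    rw [← hconst, smul_smul, ← Real.exp_add, add_neg_cancel, Real.exp_zero, one_smul]
  by_contra hne
  have hpos : 0 < ‖g t‖ := norm_pos_iff.2 hne
  obtain ⟨s, hs⟩ := (Real.tendsto_exp_atTop.eventually_gt_atTop (C / ‖g t‖)).exists
  have hb := hC (t + s)
  rw [hexp, norm_smul, Real.norm_eq_abs, Real.abs_exp, ← le_div_iff₀ hpos] at hb
  exact hb.not_gt hs

variable {E : Type*} [NormedAddCommGroup E] [InnerProductSpace ℂ E]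

/-- A symmetric linear relation on a complex inner product space. Operators enter through their
graphs, which lets closures be taken before closability is known. -/
def IsSymmetricRel (G : Submodule ℂ (E × E)) : Prop :=
  ∀ x ∈ G, ∀ y ∈ G, ⟪x.2, y.1⟫_ℂ = ⟪x.1, y.2⟫_ℂ

theorem IsSymmetricRel.topologicalClosure {G : Submodule ℂ (E × E)} (hG : IsSymmetricRel G) :
    IsSymmetricRel G.topologicalClosure := by
  have hG' : ∀ x ∈ G.topologicalClosure, ∀ y ∈ G, ⟪x.2, y.1⟫_ℂ = ⟪x.1, y.2⟫_ℂ := fun x hx y hy =>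
    closure_minimal (t := {x : E × E | ⟪x.2, y.1⟫_ℂ = ⟪x.1, y.2⟫_ℂ})
      (fun x hx => hG x hx y hy) (isClosed_eq (by fun_prop) (by fun_prop)) hx
  exact fun x hx y hy =>
    closure_minimal (t := {y : E × E | ⟪x.2, y.1⟫_ℂ = ⟪x.1, y.2⟫_ℂ})
      (fun y hy => hG' x hx y hy) (isClosed_eq (by fun_prop) (by fun_prop)) hy

theorem norm_add_I_smul_sq {ψ χ : E} (h : ⟪χ, ψ⟫_ℂ = ⟪ψ, χ⟫_ℂ) :
    ‖χ + Complex.I • ψ‖ ^ 2 = ‖χ‖ ^ 2 + ‖ψ‖ ^ 2 := by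
  have him : (⟪χ, ψ⟫_ℂ).im = 0 := by
    have := congrArg Complex.im h
    rw [← inner_conj_symm ψ χ, Complex.conj_im] at this
    linarith
  rw [@norm_add_sq ℂ, norm_smul, Complex.norm_I, one_mul, inner_smul_right]
  simp [him]

theorem norm_le_norm_add_I_smul {x : E × E} (h : ⟪x.2, x.1⟫_ℂ = ⟪x.1, x.2⟫_ℂ) :
    ‖x‖ ≤ ‖x.2 + Complex.I • x.1‖ := by
  have hsq := norm_add_I_smul_sq h
  refine max_le (abs_le_of_sq_le_sq' ?_ (norm_nonneg _)).2
    (abs_le_of_sq_le_sq' ?_ (norm_nonneg _)).2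
  · linarith [sq_nonneg ‖x.2‖]
  · linarith [sq_nonneg ‖x.1‖]

/-- The graph of the Stone generator `A` of `U`, where `U t = exp (i t A)`. -/
def generator (U : ℝ → E →L[ℂ] E) : Submodule ℂ (E × E) where
  carrier := {x | HasDerivAt (fun t => U t x.1) (Complex.I • x.2) 0}
  zero_mem' := by simpa using hasDerivAt_const (0 : ℝ) (0 : E)
  add_mem' hx hy := by simpa [Pi.add_def] using HasDerivAt.add hx hy
  smul_mem' c x hx := by
    simpa [smul_comm c Complex.I, Pi.smul_def] using HasDerivAt.const_smul c hx

theorem mem_generator {U : ℝ → E →L[ℂ] E} {x : E × E} :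
    x ∈ generator U ↔ HasDerivAt (fun t => U t x.1) (Complex.I • x.2) 0 :=
  Iff.rfl

variable [CompleteSpace E]

/-- A strongly continuous one-parameter unitary group. -/
structure IsUnitaryGroup (U : ℝ → E →L[ℂ] E) : Prop where
  unitary_mem : ∀ t, U t ∈ unitary (E →L[ℂ] E)
  map_zero : U 0 = 1
  map_add : ∀ s t, U (s + t) = U s * U t
  continuous_apply : ∀ ψ, Continuous fun t => U t ψ

theorem isUnitaryGroupOf_iff {A : E →ₗ.[ℂ] E} {U : ℝ → E →L[ℂ] E} :
    IsUnitaryGroupOf A U ↔ IsUnitaryGroup U ∧ A.graph = generator U :=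
  ⟨fun h => ⟨⟨h.unitary_mem, h.map_zero, h.map_add, h.continuous_apply⟩,
    Submodule.ext fun x => h.mem_graph_iff x.1 x.2⟩,
  fun ⟨h, hA⟩ => ⟨h.unitary_mem, h.map_zero, h.map_add, h.continuous_apply,
    fun ψ χ => by rw [hA, mem_generator]⟩⟩

namespace IsUnitaryGroup

variable {U : ℝ → E →L[ℂ] E} (hU : IsUnitaryGroup U)
include hU

theorem map_add_apply (s t : ℝ) (ψ : E) : U (s + t) ψ = U s (U t ψ) := by
  rw [hU.map_add, mul_apply_eq_comp]

theorem apply_neg_apply (t : ℝ) (ψ : E) : U t (U (-t) ψ) = ψ := by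
  rw [← hU.map_add_apply, add_neg_cancel, hU.map_zero, one_apply_eq_self]

theorem inner_apply_apply (t : ℝ) (ψ χ : E) : ⟪U t ψ, U t χ⟫_ℂ = ⟪ψ, χ⟫_ℂ :=
  (U t).inner_map_map_of_mem_unitary (hU.unitary_mem t) ψ χ

theorem norm_apply (t : ℝ) (ψ : E) : ‖U t ψ‖ = ‖ψ‖ :=
  (U t).norm_map_of_mem_unitary (hU.unitary_mem t) ψ

theorem hasDerivAt_apply {x : E × E} (hx : x ∈ generator U) (t : ℝ) :
    HasDerivAt (fun s => U s x.1) (Complex.I • U t x.2) t := by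
  have hshift : HasDerivAt (fun s => U (s - t) x.1) (Complex.I • x.2) t := by
    have : HasDerivAt (fun s => U s x.1) (Complex.I • x.2) (t - t) := by
      simpa using mem_generator.1 hx
    simpa using this.comp_sub_const t t
  rw [← map_smul]
  refine (((U t).restrictScalars ℝ).hasFDerivAt.comp_hasDerivAt t hshift).congr_of_eventuallyEq
    (Eventually.of_forall fun s => ?_)
  change U s x.1 = U t (U (s - t) x.1)
  rw [← hU.map_add_apply, add_sub_cancel]

theorem apply_mem_generator {x : E × E} (hx : x ∈ generator U) (t : ℝ) :
    (U t x.1, U t x.2) ∈ generator U := by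
  have h := ((U t).restrictScalars ℝ).hasFDerivAt.comp_hasDerivAt 0 (mem_generator.1 hx)
  rw [ContinuousLinearMap.coe_restrictScalars', map_smul] at h
  refine h.congr_of_eventuallyEq (Eventually.of_forall fun s => ?_)
  change U s (U t x.1) = U t (U s x.1)
  rw [← hU.map_add_apply, ← hU.map_add_apply, add_comm]

theorem hasDerivAt_neg_apply_curve {u : ℝ → E} {u' χ : E} {t : ℝ} (hu : HasDerivAt u u' t)
    (hχ : (u t, χ) ∈ generator U) :
    HasDerivAt (fun s => U (-s) (u s)) (U (-t) (u' - Complex.I • χ)) t := by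
  have hfixed : HasDerivAt (fun s => U (-s) (u t)) (-(Complex.I • U (-t) χ)) t := by
    simpa [Function.comp_def] using (hU.hasDerivAt_apply hχ (-t)).scomp t (hasDerivAt_neg t)
  have hmoving : HasDerivAt (fun s => U (-s) (u s - u t)) (U (-t) u') t := by
    rw [hasDerivAt_iff_tendsto_slope] at hu ⊢
    have hcont : Continuous fun s => U (-s) u' := (hU.continuous_apply u').comp continuous_neg
    have herr : Tendsto (fun s => U (-s) (slope u t s - u')) (𝓝[≠] t) (𝓝 0) := by
      rw [tendsto_zero_iff_norm_tendsto_zero]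
      simp only [hU.norm_apply]
      rw [← tendsto_zero_iff_norm_tendsto_zero]
      simpa using hu.sub_const u'
    have hsum := herr.add ((hcont.tendsto t).mono_left nhdsWithin_le_nhds)
    rw [zero_add] at hsum
    refine hsum.congr fun s => ?_
    simp [slope_def_module]
  rw [map_sub, map_smul, sub_eq_add_neg]
  refine (hmoving.add hfixed).congr_of_eventuallyEq (Eventually.of_forall fun s => ?_)
  rw [Pi.add_apply, ← _root_.map_add, sub_add_cancel]

theorem neg_apply_eq_of_hasDerivAt {u v : ℝ → E} (hu : ∀ t, HasDerivAt u (Complex.I • v t) t)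
    (huv : ∀ t, (u t, v t) ∈ generator U) (t : ℝ) : U (-t) (u t) = u 0 := by
  have hderiv (s : ℝ) : HasDerivAt (fun s => U (-s) (u s)) 0 s := by
    simpa using hU.hasDerivAt_neg_apply_curve (hu s) (huv s)
  have h := is_const_of_deriv_eq_zero (fun s => (hderiv s).differentiableAt)
    (fun s => (hderiv s).deriv) t 0
  rwa [neg_zero, hU.map_zero, one_apply_eq_self] at h

theorem eq_of_generator_eq {V : ℝ → E →L[ℂ] E} (hV : IsUnitaryGroup V)
    (hUV : generator U = generator V) (hdense : Dense (Prod.fst '' (generator U : Set (E × E)))) :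
    U = V := by
  have key : ∀ x ∈ generator U, ∀ t, U t x.1 = V t x.1 := by
    intro x hx t
    rw [hUV] at hx
    have h := hU.neg_apply_eq_of_hasDerivAt (hV.hasDerivAt_apply hx)
      (fun t => hUV ▸ hV.apply_mem_generator hx t) t
    rw [hV.map_zero, one_apply_eq_self] at h
    rw [← hU.apply_neg_apply t (V t x.1), h]
  funext t
  exact ContinuousLinearMap.ext fun ψ => congrFun (Continuous.ext_on hdense (U t).continuous
    (V t).continuous (by rintro _ ⟨x, hx, rfl⟩; exact key x hx t)) ψ

theorem isSymmetricRel_generator : IsSymmetricRel (generator U) := by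
  intro x hx y hy
  have hconst : HasDerivAt (fun _ : ℝ => ⟪x.1, y.1⟫_ℂ) (⟪x.1, Complex.I • y.2⟫_ℂ +
      ⟪Complex.I • x.2, y.1⟫_ℂ) 0 := by
    simpa only [hU.inner_apply_apply, hU.map_zero, one_apply_eq_self] using
      (mem_generator.1 hx).inner ℂ (mem_generator.1 hy)
  have h := hconst.unique (hasDerivAt_const _ _)
  rw [inner_smul_right, inner_smul_left, Complex.conj_I] at h
  refine mul_left_cancel₀ Complex.I_ne_zero ?_
  linear_combination -h

theorem isClosed_generator : IsClosed (generator U : Set (E × E)) := by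
  refine isClosed_of_closure_subset fun z hz => ?_
  obtain ⟨x, hx, hlim⟩ := mem_closure_iff_seq_limit.1 hz
  have hfst : Tendsto (fun n => (x n).1) atTop (𝓝 z.1) := (continuous_fst.tendsto _).comp hlim
  have hsnd : Tendsto (fun n => (x n).2) atTop (𝓝 z.2) := (continuous_snd.tendsto _).comp hlim
  have hunif : TendstoUniformly (fun n t => Complex.I • U t (x n).2)
      (fun t => Complex.I • U t z.2) atTop := by
    rw [Metric.tendstoUniformly_iff]
    intro ε hε
    filter_upwards [Metric.tendsto_nhds.1 hsnd ε hε] with n hn t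
    rwa [dist_eq_norm, ← smul_sub, norm_smul, Complex.norm_I, one_mul, ← map_sub, hU.norm_apply,
      ← dist_eq_norm, dist_comm]
  have h := hasDerivAt_of_tendstoUniformly hunif
    (Eventually.of_forall fun n t => hU.hasDerivAt_apply (hx n) t)
    (fun t => ((U t).continuous.tendsto _).comp hfst) 0
  rwa [hU.map_zero, one_apply_eq_self] at h

theorem eq_zero_of_orthogonal_range {G : Submodule ℂ (E × E)} (hG : G ≤ generator U)
    (hinv : ∀ x ∈ G, ∀ t, (U t x.1, U t x.2) ∈ G)
    (hdense : Dense (Prod.fst '' (G : Set (E × E)))) {η : E}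
    (hη : ∀ x ∈ G, ⟪η, x.2 + Complex.I • x.1⟫_ℂ = 0) : η = 0 := by
  have horth : ∀ x ∈ G, ⟪η, x.1⟫_ℂ = 0 := by
    intro x hx
    have hderiv (t : ℝ) : HasDerivAt (fun t => ⟪η, U t x.1⟫_ℂ) ⟪η, U t x.1⟫_ℂ t := by
      have hzero := hη _ (hinv x hx t)
      refine ((hasDerivAt_const t η).inner ℂ (hU.hasDerivAt_apply (hG hx) t)).congr_deriv ?_
      rw [inner_add_right, inner_smul_right] at hzero
      rw [inner_smul_right, inner_zero_left, add_zero]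
      linear_combination Complex.I * hzero - ⟪η, U t x.1⟫_ℂ * Complex.I_mul_I
    have h := eq_zero_of_hasDerivAt_self_of_norm_le hderiv
      (fun t => (norm_inner_le_norm η _).trans_eq (by rw [hU.norm_apply])) 0
    rwa [hU.map_zero, one_apply_eq_self] at h
  have h : (fun y => ⟪η, y⟫_ℂ) = fun _ => 0 :=
    Continuous.ext_on hdense (by fun_prop) continuous_const
      (by rintro _ ⟨x, hx, rfl⟩; exact horth x hx)
  exact inner_self_eq_zero.1 (congrFun h η)

/-- By invariance the range of `A + i` is dense, so that any `x` in a symmetric relation extending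
`G₀` is approximated by points `y ∈ G₀` with `(A + i) (y - x)` small; symmetry turns this into
smallness of `y - x`. -/
theorem le_topologicalClosure_of_isSymmetricRel {G₀ G : Submodule ℂ (E × E)}
    (hG₀ : G₀ ≤ generator U) (hinv : ∀ x ∈ G₀, ∀ t, (U t x.1, U t x.2) ∈ G₀)
    (hdense : Dense (Prod.fst '' (G₀ : Set (E × E)))) (hle : G₀ ≤ G) (hG : IsSymmetricRel G) :
    G ≤ G₀.topologicalClosure := by
  let R : Submodule ℂ E := G₀.map (LinearMap.snd ℂ E E + Complex.I • LinearMap.fst ℂ E E)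
  have hR : R.topologicalClosure = ⊤ := by
    rw [Submodule.topologicalClosure_eq_top_iff, Submodule.eq_bot_iff]
    intro η hη
    exact hU.eq_zero_of_orthogonal_range hG₀ hinv hdense fun x hx =>
      Submodule.inner_left_of_mem_orthogonal (K := R) ⟨x, hx, rfl⟩ hη
  intro x hx
  have hmem : x.2 + Complex.I • x.1 ∈ closure (R : Set E) := by
    rw [← Submodule.topologicalClosure_coe, hR]
    exact Set.mem_univ _
  rw [← SetLike.mem_coe, Submodule.topologicalClosure_coe, Metric.mem_closure_iff]
  intro ε hε
  obtain ⟨_, ⟨y, hy, rfl⟩, hyd⟩ := Metric.mem_closure_iff.1 hmem ε hε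
  have hyx : y - x ∈ G := sub_mem (hle hy) hx
  refine ⟨y, hy, ?_⟩
  rw [dist_comm, dist_eq_norm] at hyd ⊢
  refine (norm_le_norm_add_I_smul (hG _ hyx _ hyx)).trans_lt ?_
  rwa [Prod.snd_sub, Prod.fst_sub, smul_sub, sub_add_sub_comm]

theorem topologicalClosure_eq_generator {G₀ G : Submodule ℂ (E × E)} (hG₀ : G₀ ≤ generator U)
    (hinv : ∀ x ∈ G₀, ∀ t, (U t x.1, U t x.2) ∈ G₀)
    (hdense : Dense (Prod.fst '' (G₀ : Set (E × E)))) (hle : G₀ ≤ G) (hG : IsSymmetricRel G) :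
    G.topologicalClosure = generator U := by
  have hclosed : G₀.topologicalClosure ≤ generator U :=
    Submodule.topologicalClosure_minimal _ hG₀ hU.isClosed_generator
  refine le_antisymm ?_ ?_
  · exact (hU.le_topologicalClosure_of_isSymmetricRel hG₀ hinv hdense
      (hle.trans G.le_topologicalClosure) hG.topologicalClosure).trans hclosed
  · exact (hU.le_topologicalClosure_of_isSymmetricRel hG₀ hinv hdense hG₀
      hU.isSymmetricRel_generator).trans (Submodule.topologicalClosure_mono hle)

theorem isUnitaryGroupOf_closure {T : E →ₗ.[ℂ] E}
    (hT : T.graph.topologicalClosure = generator U) : IsUnitaryGroupOf T.closure U := by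
  have hclosable : T.IsClosable := by
    refine ⟨T.graph.topologicalClosure.toLinearPMap, ?_⟩
    rw [Submodule.toLinearPMap_graph_eq]
    rintro ⟨ψ, χ⟩ hx rfl
    rw [hT, mem_generator] at hx
    have hzero : HasDerivAt (fun t => U t (0 : E)) 0 0 := by
      simpa using hasDerivAt_const (0 : ℝ) (0 : E)
    exact (smul_eq_zero.1 (hx.unique hzero)).resolve_left Complex.I_ne_zero
  exact isUnitaryGroupOf_iff.2 ⟨hU, hclosable.graph_closure_eq_closure_graph ▸ hT⟩

theorem expI_closure_eq {T : E →ₗ.[ℂ] E} (hT : T.graph.topologicalClosure = generator U)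
    (hdense : Dense (T.domain : Set E)) : expI T.closure = U := by
  have hUT := hU.isUnitaryGroupOf_closure hT
  have hex : ∃ V : ℝ → E →L[ℂ] E, IsUnitaryGroupOf T.closure V := ⟨U, hUT⟩
  obtain ⟨hV, hVT⟩ := isUnitaryGroupOf_iff.1 hex.choose_spec
  have hfst : (T.domain : Set E) ⊆ Prod.fst '' (generator hex.choose : Set (E × E)) := by
    intro ψ hψ
    exact ⟨_, hVT ▸ LinearPMap.le_graph_of_le T.le_closure (T.mem_graph ⟨ψ, hψ⟩), rfl⟩
  funext t
  rw [expI, dif_pos hex, hV.eq_of_generator_eq hU (hVT ▸ (isUnitaryGroupOf_iff.1 hUT).2)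
    (hdense.mono hfst)]

end IsUnitaryGroup

theorem mem_unitary_of_norm_apply {U V : E →L[ℂ] E} (hU : ∀ ψ, ‖U ψ‖ = ‖ψ‖) (hUV : U * V = 1) :
    U ∈ unitary (E →L[ℂ] E) := by
  have hleft : star U * U = 1 := (ContinuousLinearMap.norm_map_iff_adjoint_comp_self U).1 hU
  exact Unitary.mem_iff.2 ⟨hleft, left_inv_eq_right_inv hleft hUV ▸ hUV⟩

theorem IsUnitaryGroup.of_norm_apply {U : ℝ → E →L[ℂ] E} (hnorm : ∀ t ψ, ‖U t ψ‖ = ‖ψ‖)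
    (hzero : U 0 = 1) (hadd : ∀ s t, U (s + t) = U s * U t) {D : Set E} (hD : Dense D)
    (hcont : ∀ ψ ∈ D, Continuous fun t => U t ψ) : IsUnitaryGroup U where
  unitary_mem t := mem_unitary_of_norm_apply (V := U (-t)) (hnorm t)
    (by rw [← hadd, add_neg_cancel, hzero])
  map_zero := hzero
  map_add := hadd
  continuous_apply ψ := by
    refine continuous_of_uniform_approx_of_continuous fun u hu => ?_
    obtain ⟨ε, hε, hεu⟩ := Metric.mem_uniformity_dist.1 hu
    obtain ⟨φ, hφ, hd⟩ := hD.exists_dist_lt ψ hε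
    refine ⟨fun t => U t φ, hcont φ hφ, fun t => hεu ?_⟩
    rwa [dist_eq_norm, ← map_sub, hnorm, ← dist_eq_norm]

end UnitaryGroups

section Eigenvectors

variable {E ι : Type*} [NormedAddCommGroup E] [InnerProductSpace ℂ E] {e : ι → E} {w : ι → ℝ}

theorem norm_linearCombination_phase (horth : ∀ i j, w i ≠ w j → ⟪e i, e j⟫_ℂ = 0) (t : ℝ)
    (c : ι →₀ ℂ) :
    ‖Finsupp.linearCombination ℂ (fun i => Complex.exp (Complex.I * t * w i) • e i) c‖
      = ‖Finsupp.linearCombination ℂ e c‖ := by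
  rw [@norm_eq_sqrt_re_inner ℂ, @norm_eq_sqrt_re_inner ℂ _ _ _ _ (Finsupp.linearCombination ℂ e c)]
  congr 2
  simp only [Finsupp.linearCombination_apply, Finsupp.sum, sum_inner, inner_sum]
  refine Finset.sum_congr rfl fun i _ => Finset.sum_congr rfl fun j _ => ?_
  simp only [inner_smul_left, inner_smul_right]
  by_cases h : w j = w i
  · have hphase : (starRingEnd ℂ) (Complex.exp (Complex.I * t * w i)) *
        Complex.exp (Complex.I * t * w i) = 1 := by
      rw [← Complex.exp_conj, ← Complex.exp_add]
      simp
    rw [h]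
    linear_combination c i * (starRingEnd ℂ) (c j) * ⟪e j, e i⟫_ℂ * hphase
  · rw [horth j i h, mul_zero, mul_zero, mul_zero, mul_zero]

theorem span_le_generator_of_eigenvectors {U : ℝ → E →L[ℂ] E}
    (hUe : ∀ t i, U t (e i) = Complex.exp (Complex.I * t * w i) • e i) :
    Submodule.span ℂ (Set.range fun i => (e i, (w i : ℂ) • e i)) ≤ generator U := by
  rw [Submodule.span_le]
  rintro _ ⟨i, rfl⟩
  have hphase : HasDerivAt (fun t : ℝ => Complex.exp (Complex.I * t * w i))
      (Complex.I * w i) 0 := by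
    have := (((hasDerivAt_id (0 : ℝ)).ofReal_comp.const_mul Complex.I).mul_const (w i : ℂ)).cexp
    simpa using this
  rw [SetLike.mem_coe, mem_generator]
  simp only [hUe, smul_smul]
  exact hphase.smul_const (e i)

theorem prodMap_mem_span_of_eigenvectors {U : ℝ → E →L[ℂ] E}
    (hUe : ∀ t i, U t (e i) = Complex.exp (Complex.I * t * w i) • e i) (t : ℝ) {x : E × E}
    (hx : x ∈ Submodule.span ℂ (Set.range fun i => (e i, (w i : ℂ) • e i))) :
    (U t x.1, U t x.2) ∈ Submodule.span ℂ (Set.range fun i => (e i, (w i : ℂ) • e i)) := by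
  have hle : Submodule.span ℂ (Set.range fun i => (e i, (w i : ℂ) • e i)) ≤
      (Submodule.span ℂ (Set.range fun i => (e i, (w i : ℂ) • e i))).comap
        ((U t).toLinearMap.prodMap (U t).toLinearMap) := by
    rw [Submodule.span_le]
    rintro _ ⟨i, rfl⟩
    simp only [Submodule.comap_coe, Set.mem_preimage, LinearMap.prodMap_apply,
      ContinuousLinearMap.coe_coe, map_smul, hUe]
    rw [smul_comm, ← Prod.smul_mk]
    exact Submodule.smul_mem _ _ (Submodule.subset_span ⟨i, rfl⟩)
  exact hle hx

variable [CompleteSpace E]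

theorem exists_isUnitaryGroup_of_eigenvectors (horth : ∀ i j, w i ≠ w j → ⟪e i, e j⟫_ℂ = 0)
    (hdense : Dense (Submodule.span ℂ (Set.range e) : Set E)) :
    ∃ U : ℝ → E →L[ℂ] E, IsUnitaryGroup U ∧
      ∀ t i, U t (e i) = Complex.exp (Complex.I * t * w i) • e i := by
  have hrange : DenseRange (Finsupp.linearCombination ℂ e) := by
    rwa [DenseRange, ← LinearMap.coe_range, Finsupp.range_linearCombination]
  let f : ℝ → (ι →₀ ℂ) →ₗ[ℂ] E := fun t =>
    Finsupp.linearCombination ℂ (fun i => Complex.exp (Complex.I * t * w i) • e i)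
  let U : ℝ → E →L[ℂ] E := fun t => (f t).extendOfNorm (Finsupp.linearCombination ℂ e)
  have hUf (t : ℝ) (c : ι →₀ ℂ) : U t (Finsupp.linearCombination ℂ e c) = f t c :=
    LinearMap.extendOfNorm_eq hrange
      ⟨1, fun c => by rw [one_mul]; exact (norm_linearCombination_phase horth t c).le⟩ c
  have hUe (t : ℝ) (i : ι) : U t (e i) = Complex.exp (Complex.I * t * w i) • e i := by
    simpa [f] using hUf t (Finsupp.single i 1)
  have hext {A B : E →L[ℂ] E} (h : ∀ i, A (e i) = B (e i)) : A = B :=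
    ContinuousLinearMap.ext_on hdense (by rintro _ ⟨i, rfl⟩; exact h i)
  refine ⟨U, .of_norm_apply (fun t ψ => ?_) (hext fun i => ?_) (fun s t => hext fun i => ?_)
    hrange ?_, hUe⟩
  · refine hrange.induction_on (p := fun ψ => ‖U t ψ‖ = ‖ψ‖) ψ
      (isClosed_eq (by fun_prop) (by fun_prop)) fun c => ?_
    rw [hUf]
    exact norm_linearCombination_phase horth t c
  · simp [hUe]
  · rw [mul_apply_eq_comp, hUe, hUe, map_smul, hUe, smul_smul, ← Complex.exp_add]
    congr 2
    push_cast
    ring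
  · rintro _ ⟨c, rfl⟩
    simp only [hUf]
    simp only [f, Finsupp.linearCombination_apply, Finsupp.sum]
    fun_prop

theorem exists_generator_eq_of_eigenvectors {G : Submodule ℂ (E × E)} (hG : IsSymmetricRel G)
    (he : ∀ i, (e i, (w i : ℂ) • e i) ∈ G)
    (hdense : Dense (Submodule.span ℂ (Set.range e) : Set E)) :
    ∃ U : ℝ → E →L[ℂ] E, IsUnitaryGroup U ∧ G.topologicalClosure = generator U := by
  have horth (i j : ι) (hij : w i ≠ w j) : ⟪e i, e j⟫_ℂ = 0 := by
    have h := hG _ (he i) _ (he j)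
    simp only [inner_smul_left, inner_smul_right, Complex.conj_ofReal] at h
    have hmul : ((w i : ℂ) - w j) * ⟪e i, e j⟫_ℂ = 0 := by linear_combination h
    exact (mul_eq_zero.1 hmul).resolve_left (sub_ne_zero.2 (by exact_mod_cast hij))
  obtain ⟨U, hU, hUe⟩ := exists_isUnitaryGroup_of_eigenvectors horth hdense
  have hfst : Prod.fst '' ((Submodule.span ℂ (Set.range fun i => (e i, (w i : ℂ) • e i)) :
      Submodule ℂ (E × E)) : Set (E × E)) = Submodule.span ℂ (Set.range e) := by
    rw [← LinearMap.coe_fst (R := ℂ), ← Submodule.map_coe, Submodule.map_span, ← Set.range_comp]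
    rfl
  exact ⟨U, hU, hU.topologicalClosure_eq_generator (span_le_generator_of_eigenvectors hUe)
    (fun x hx t => prodMap_mem_span_of_eigenvectors hUe t hx) (hfst ▸ hdense)
    (Submodule.span_le.2 (Set.range_subset_iff.2 he)) hG⟩

end Eigenvectors

/-! ### Operators on Schwartz functions -/

section SchwartzOperators

variable {V : Type*} [NormedAddCommGroup V] [InnerProductSpace ℝ V] [FiniteDimensional ℝ V]
  [MeasurableSpace V] [BorelSpace V]

/-- The embedding of the Schwartz functions into `L²`. -/
def toL2 : 𝓢(V, ℂ) →ₗ[ℂ] Lp ℂ 2 (volume : Measure V) :=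
  (SchwartzMap.toLpCLM ℂ ℂ 2 (volume : Measure V)).toLinearMap

theorem denseRange_toL2 : DenseRange (toL2 : 𝓢(V, ℂ) → Lp ℂ 2 (volume : Measure V)) :=
  SchwartzMap.denseRange_toLpCLM (E := V) (F := ℂ) (μ := volume) ENNReal.ofNat_ne_top

theorem inner_toL2 (φ χ : 𝓢(V, ℂ)) : ⟪toL2 φ, toL2 χ⟫_ℂ = ∫ q, ⟪φ q, χ q⟫_ℂ :=
  SchwartzMap.inner_toL2_toL2_eq φ χ volume

theorem norm_toL2_sq (φ : 𝓢(V, ℂ)) : ‖toL2 φ‖ ^ 2 = ∫ q, ‖φ q‖ ^ 2 := by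
  have h : ((‖toL2 φ‖ ^ 2 : ℝ) : ℂ) = ((∫ q, ‖φ q‖ ^ 2 : ℝ) : ℂ) := by
    push_cast
    rw [← integral_complex_ofReal]
    refine (inner_self_eq_norm_sq_to_K (𝕜 := ℂ) (toL2 φ)).symm.trans
      ((inner_toL2 φ φ).trans (integral_congr_ae (Eventually.of_forall fun q => ?_)))
    simp [inner_self_eq_norm_sq_to_K]
  exact_mod_cast h

/-- The graph in `L²` of an operator with domain the Schwartz functions. -/
def schwartzGraph (T : Module.End ℂ 𝓢(V, ℂ)) :
    Submodule ℂ (Lp ℂ 2 (volume : Measure V) × Lp ℂ 2 (volume : Measure V)) :=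
  LinearMap.range (toL2.prod (toL2 ∘ₗ T))

theorem toL2_mem_schwartzGraph (T : Module.End ℂ 𝓢(V, ℂ)) (φ : 𝓢(V, ℂ)) :
    (toL2 φ, toL2 (T φ)) ∈ schwartzGraph T :=
  ⟨φ, rfl⟩

theorem dense_fst_image_schwartzGraph (T : Module.End ℂ 𝓢(V, ℂ)) :
    Dense (Prod.fst '' (schwartzGraph T :
      Set (Lp ℂ 2 (volume : Measure V) × Lp ℂ 2 (volume : Measure V)))) :=
  denseRange_toL2.mono (Set.range_subset_iff.2 fun φ => ⟨_, toL2_mem_schwartzGraph T φ, rfl⟩)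

theorem clm_ext_toL2 {A B : Lp ℂ 2 (volume : Measure V) →L[ℂ] Lp ℂ 2 (volume : Measure V)}
    (h : ∀ φ, A (toL2 φ) = B (toL2 φ)) : A = B :=
  ContinuousLinearMap.ext fun ψ => congrFun
    (denseRange_toL2.equalizer A.continuous B.continuous (funext h)) ψ

/-- `T` is symmetric with respect to the inner product of `L²`. -/
def IsSymmetricOp (T : Module.End ℂ 𝓢(V, ℂ)) : Prop :=
  ∀ φ χ, ⟪toL2 (T φ), toL2 χ⟫_ℂ = ⟪toL2 φ, toL2 (T χ)⟫_ℂ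

namespace IsSymmetricOp

variable {S T : Module.End ℂ 𝓢(V, ℂ)}

theorem add (hS : IsSymmetricOp S) (hT : IsSymmetricOp T) : IsSymmetricOp (S + T) := fun φ χ => by
  rw [LinearMap.add_apply, LinearMap.add_apply, map_add, map_add, inner_add_left, inner_add_right,
    hS, hT]

theorem real_smul (hT : IsSymmetricOp T) (c : ℝ) : IsSymmetricOp ((c : ℂ) • T) := fun φ χ => by
  rw [LinearMap.smul_apply, LinearMap.smul_apply, map_smul, map_smul, inner_smul_left,
    inner_smul_right, Complex.conj_ofReal, hT]

theorem sq (hT : IsSymmetricOp T) : IsSymmetricOp (T ^ 2) := fun φ χ => by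
  rw [pow_two, Module.End.mul_apply, Module.End.mul_apply, hT, hT]

theorem sum {ι : Type*} {s : Finset ι} {T : ι → Module.End ℂ 𝓢(V, ℂ)}
    (hT : ∀ i ∈ s, IsSymmetricOp (T i)) : IsSymmetricOp (∑ i ∈ s, T i) :=
  Finset.sum_induction _ _ (fun _ _ => add) (fun φ χ => by simp) hT

theorem isSymmetricRel_schwartzGraph (hT : IsSymmetricOp T) : IsSymmetricRel (schwartzGraph T) := by
  rintro _ ⟨φ, rfl⟩ _ ⟨χ, rfl⟩
  exact hT φ χ

end IsSymmetricOp

end SchwartzOperators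

section PositionMomentum

variable {V : Type*} [NormedAddCommGroup V] [InnerProductSpace ℝ V]

/-- The position operator in the direction `a`: multiplication by `q ↦ ⟪a, q⟫`. -/
def posAlong (a : V) : Module.End ℂ 𝓢(V, ℂ) :=
  (SchwartzMap.smulLeftCLM ℂ fun q : V => ((⟪a, q⟫_ℝ : ℝ) : ℂ)).toLinearMap

/-- The momentum operator `-i ∂_b` in the direction `b`. -/
def momAlong (b : V) : Module.End ℂ 𝓢(V, ℂ) :=
  (-Complex.I) • (LineDeriv.lineDerivOpCLM ℂ 𝓢(V, ℂ) b).toLinearMap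

theorem posAlong_apply (a : V) (φ : 𝓢(V, ℂ)) (q : V) :
    posAlong a φ q = (⟪a, q⟫_ℝ : ℂ) * φ q :=
  SchwartzMap.smulLeftCLM_apply_apply
    (Complex.ofRealCLM.comp (innerSL ℝ a)).hasTemperateGrowth φ q

theorem posAlong_pow_apply (a : V) (n : ℕ) (φ : 𝓢(V, ℂ)) (q : V) :
    (posAlong a ^ n) φ q = (⟪a, q⟫_ℝ : ℂ) ^ n * φ q := by
  induction n with
  | zero => simp
  | succ n ih => rw [pow_succ', Module.End.mul_apply, posAlong_apply, ih, pow_succ', mul_assoc]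

theorem momAlong_eq (b : V) (φ : 𝓢(V, ℂ)) : momAlong b φ = (-Complex.I) • ∂_{b} φ := rfl

theorem momAlong_apply (b : V) (φ : 𝓢(V, ℂ)) (q : V) :
    momAlong b φ q = -Complex.I * fderiv ℝ φ q b := by
  rw [momAlong_eq, smul_apply, SchwartzMap.lineDerivOp_apply_eq_fderiv, smul_eq_mul]

theorem posAlong_sum_smul {ι : Type*} (s : Finset ι) (c : ι → ℝ) (a : ι → V) :
    posAlong (∑ i ∈ s, c i • a i) = ∑ i ∈ s, (c i : ℂ) • posAlong (a i) := by
  ext φ q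
  simp [posAlong_apply, sum_inner, inner_smul_left, Finset.sum_mul, mul_assoc]

theorem momAlong_sum_smul {ι : Type*} (s : Finset ι) (c : ι → ℝ) (b : ι → V) :
    momAlong (∑ i ∈ s, c i • b i) = ∑ i ∈ s, (c i : ℂ) • momAlong (b i) := by
  ext φ q
  simp [momAlong_apply, Finset.mul_sum, mul_left_comm]

variable [FiniteDimensional ℝ V] [MeasurableSpace V] [BorelSpace V]

theorem isSymmetricOp_posAlong (a : V) : IsSymmetricOp (posAlong a) := by
  intro φ χ
  rw [inner_toL2, inner_toL2]
  refine integral_congr_ae (Eventually.of_forall fun q => ?_)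
  simp only [posAlong_apply, RCLike.inner_apply, map_mul, Complex.conj_ofReal]
  ring

theorem isSymmetricOp_momAlong (b : V) : IsSymmetricOp (momAlong b) := by
  intro φ χ
  have h := SchwartzMap.integral_bilinear_lineDerivOp_right_eq_neg_left (μ := volume) φ χ
    ((ContinuousLinearMap.mul ℝ ℂ).comp (Complex.conjCLE : ℂ →L[ℝ] ℂ)) b
  simp only [ContinuousLinearMap.comp_apply, ContinuousLinearMap.mul_apply',
    ContinuousLinearEquiv.coe_coe, Complex.conjCLE_apply] at h
  rw [momAlong_eq, momAlong_eq, map_smul, map_smul, inner_smul_left, inner_smul_right, inner_toL2,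
    inner_toL2]
  simp only [RCLike.inner_apply']
  rw [h]
  simp

end PositionMomentum

/-! ### Differentiation in `L²` -/

section Differentiation

/-- The curve `u` in the complex space `E` has derivative `u'` at `t`. Stating this for a generic
space `E` selects the real structure obtained by restricting scalars; the real structure which
instance search finds on a concrete `L²` space is a different term. -/
abbrev HasCurveDerivAt {E : Type*} [NormedAddCommGroup E] [NormedSpace ℂ E] (u : ℝ → E) (u' : E)
    (t : ℝ) : Prop :=
  HasDerivAt u u' t

theorem hasCurveDerivAt_iff {E : Type*} [NormedAddCommGroup E] [NormedSpace ℂ E] {u : ℝ → E}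
    {u' : E} {t : ℝ} : HasCurveDerivAt u u' t ↔
      Tendsto (fun s : ℝ => (((s - t)⁻¹ : ℝ) : ℂ) • (u s - u t)) (𝓝[≠] t) (𝓝 u') :=
  hasDerivAt_iff_tendsto_slope

theorem norm_slope_sub_le_of_norm_deriv_le {F : Type*} [NormedAddCommGroup F] [NormedSpace ℝ F]
    {f f' : ℝ → F} {t δ C : ℝ} (hf : ∀ s ∈ Metric.ball t δ, HasDerivAt f (f' s) s)
    (hC : ∀ s ∈ Metric.ball t δ, ‖f' s‖ ≤ C) {s : ℝ} (hs : s ∈ Metric.ball t δ) :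
    ‖slope f t s - f' t‖ ≤ 2 * C := by
  have ht : t ∈ Metric.ball t δ := Metric.mem_ball_self (dist_nonneg.trans_lt hs)
  have hslope : ‖slope f t s‖ ≤ C := by
    rcases eq_or_ne s t with rfl | hne
    · rw [slope_same, norm_zero]
      exact (norm_nonneg _).trans (hC s ht)
    · rw [slope_def_module, norm_smul, norm_inv,
        inv_mul_le_iff₀ (norm_pos_iff.2 (sub_ne_zero.2 hne)), mul_comm]
      exact (convex_ball t δ).norm_image_sub_le_of_norm_hasDerivWithin_le
        (fun s hs => (hf s hs).hasDerivWithinAt) hC ht hs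
  linarith [norm_sub_le (slope f t s) (f' t), hC t ht]

variable {V : Type*} [NormedAddCommGroup V] [InnerProductSpace ℝ V] [FiniteDimensional ℝ V]
  [MeasurableSpace V] [BorelSpace V]

theorem hasCurveDerivAt_toL2_of_dominated {F : ℝ → 𝓢(V, ℂ)} {D : ℝ → 𝓢(V, ℂ)} {t δ : ℝ}
    {g : V → ℝ} (hδ : 0 < δ)
    (hF : ∀ q, ∀ s ∈ Metric.ball t δ, HasDerivAt (fun s => F s q) (D s q) s)
    (hD : ∀ q, ∀ s ∈ Metric.ball t δ, ‖D s q‖ ≤ g q) (hg : Integrable fun q => g q ^ 2) :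
    HasCurveDerivAt (fun s => toL2 (F s)) (toL2 (D t)) t := by
  have hslope (q : V) (s : ℝ) : ((((s - t)⁻¹ : ℝ) : ℂ) • (F s - F t) - D t) q =
      slope (fun s => F s q) t s - D t q := by
    simp [slope_def_module]
  have hlim : Tendsto (fun s : ℝ => ∫ q, ‖((((s - t)⁻¹ : ℝ) : ℂ) • (F s - F t) - D t) q‖ ^ 2)
      (𝓝[≠] t) (𝓝 (∫ _ : V, (0 : ℝ))) := by
    refine tendsto_integral_filter_of_dominated_convergence (fun q => 4 * g q ^ 2)
      (Eventually.of_forall fun s => (by fun_prop : Continuous _).aestronglyMeasurable) ?_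
      (hg.const_mul 4) (Eventually.of_forall fun q => ?_)
    · filter_upwards [eventually_nhdsWithin_of_eventually_nhds (Metric.ball_mem_nhds t hδ)]
        with s hs
      refine Eventually.of_forall fun q => ?_
      rw [norm_pow, norm_norm, hslope]
      calc ‖slope (fun s => F s q) t s - D t q‖ ^ 2 ≤ (2 * g q) ^ 2 :=
            pow_le_pow_left₀ (norm_nonneg _)
              (norm_slope_sub_le_of_norm_deriv_le (hF q) (hD q) hs) 2
        _ = 4 * g q ^ 2 := by ring
    · have h := (hasDerivAt_iff_tendsto_slope.1 (hF q t (Metric.mem_ball_self hδ))).sub_const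
        (D t q)
      rw [sub_self] at h
      simpa only [hslope, norm_zero, zero_pow two_ne_zero] using h.norm.pow 2
  rw [hasCurveDerivAt_iff, tendsto_iff_norm_sub_tendsto_zero]
  rw [integral_zero] at hlim
  have hsqrt := hlim.sqrt
  rw [Real.sqrt_zero] at hsqrt
  refine hsqrt.congr fun s => ?_
  rw [← norm_toL2_sq, Real.sqrt_sq (norm_nonneg _), map_sub, map_smul, map_sub]

end Differentiation

/-! ### Weyl operators -/

section WeylSchwartz

theorem norm_cexp_I_mul_ofReal (s : ℝ) : ‖Complex.exp (Complex.I * s)‖ = 1 := by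
  rw [mul_comm, Complex.norm_exp_ofReal_mul_I]

theorem iteratedDeriv_cexp_I_mul (n : ℕ) :
    iteratedDeriv n (fun s : ℝ => Complex.exp (Complex.I * s)) =
      fun s : ℝ => Complex.I ^ n * Complex.exp (Complex.I * s) := by
  induction n with
  | zero => simp
  | succ n ih =>
    rw [iteratedDeriv_succ, ih]
    funext s
    have h : HasDerivAt (fun s : ℝ => Complex.exp (Complex.I * s))
        (Complex.exp (Complex.I * s) * Complex.I) s := by
      simpa using ((hasDerivAt_id s).ofReal_comp.const_mul Complex.I).cexp
    rw [(h.const_mul _).deriv]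
    ring

theorem hasTemperateGrowth_cexp_I_mul :
    Function.HasTemperateGrowth fun s : ℝ => Complex.exp (Complex.I * s) := by
  refine ⟨(contDiff_const.mul Complex.ofRealCLM.contDiff).cexp, fun n => ⟨0, 1, fun s => ?_⟩⟩
  rw [norm_iteratedFDeriv_eq_norm_iteratedDeriv, iteratedDeriv_cexp_I_mul]
  simp

variable {V : Type*} [NormedAddCommGroup V] [InnerProductSpace ℝ V]

theorem hasTemperateGrowth_cexp_inner_add (a : V) (c : ℝ) :
    Function.HasTemperateGrowth
      fun q : V => Complex.exp (Complex.I * ((⟪a, q⟫_ℝ + c : ℝ) : ℂ)) :=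
  hasTemperateGrowth_cexp_I_mul.comp
    ((innerSL ℝ a).hasTemperateGrowth.add (Function.HasTemperateGrowth.const c))

/-- The Weyl operator `exp (i (Q(a) + P(b)))`, in its explicit form
`φ ↦ exp (i (a · q + a · b / 2)) φ (q + b)`, on Schwartz functions. -/
def weylSchwartz (a b : V) : Module.End ℂ 𝓢(V, ℂ) :=
  (SchwartzMap.smulLeftCLM ℂ fun q : V =>
      Complex.exp (Complex.I * ((⟪a, q⟫_ℝ + ⟪a, b⟫_ℝ / 2 : ℝ) : ℂ))).toLinearMap ∘ₗ
    (SchwartzMap.compSubConstCLM ℂ (-b)).toLinearMap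

theorem weylSchwartz_apply (a b : V) (φ : 𝓢(V, ℂ)) (q : V) :
    weylSchwartz a b φ q =
      Complex.exp (Complex.I * ((⟪a, q⟫_ℝ + ⟪a, b⟫_ℝ / 2 : ℝ) : ℂ)) * φ (q + b) := by
  refine (SchwartzMap.smulLeftCLM_apply_apply (hasTemperateGrowth_cexp_inner_add a _) _ q).trans ?_
  rw [smul_eq_mul, ContinuousLinearMap.coe_coe, SchwartzMap.compSubConstCLM_apply, sub_neg_eq_add]

theorem norm_weylSchwartz_apply (a b : V) (φ : 𝓢(V, ℂ)) (q : V) :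
    ‖weylSchwartz a b φ q‖ = ‖φ (q + b)‖ := by
  rw [weylSchwartz_apply, norm_mul, norm_cexp_I_mul_ofReal, one_mul]

theorem weylSchwartz_weylSchwartz (a b a' b' : V) (φ : 𝓢(V, ℂ)) :
    weylSchwartz a b (weylSchwartz a' b' φ) =
      Complex.exp (Complex.I * ((⟪a', b⟫_ℝ - ⟪a, b'⟫_ℝ : ℝ) / 2)) •
        weylSchwartz (a + a') (b + b') φ := by
  ext q
  simp only [weylSchwartz_apply, smul_apply, smul_eq_mul, ← mul_assoc, ← Complex.exp_add,
    inner_add_left, inner_add_right, add_assoc]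
  congr 2
  push_cast
  ring

theorem weylSchwartz_zero (φ : 𝓢(V, ℂ)) : weylSchwartz 0 0 φ = φ := by
  ext q
  simp [weylSchwartz_apply]

theorem posAlong_weylSchwartz (u a b : V) (φ : 𝓢(V, ℂ)) :
    posAlong u (weylSchwartz a b φ) =
      weylSchwartz a b (posAlong u φ - (⟪u, b⟫_ℝ : ℂ) • φ) := by
  ext q
  simp only [posAlong_apply, weylSchwartz_apply, sub_apply, smul_apply, smul_eq_mul,
    inner_add_right]
  push_cast
  ring

theorem fderiv_weylSchwartz_apply (a b : V) (φ : 𝓢(V, ℂ)) (q v : V) :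
    fderiv ℝ (weylSchwartz a b φ) q v =
      Complex.exp (Complex.I * ((⟪a, q⟫_ℝ + ⟪a, b⟫_ℝ / 2 : ℝ) : ℂ)) *
        (Complex.I * (⟪a, v⟫_ℝ : ℂ) * φ (q + b) + fderiv ℝ φ (q + b) v) := by
  have hphase : HasFDerivAt
      (fun q : V => Complex.exp (Complex.I * ((⟪a, q⟫_ℝ + ⟪a, b⟫_ℝ / 2 : ℝ) : ℂ))) _ q :=
    ((Complex.ofRealCLM.hasFDerivAt.comp q
      ((innerSL ℝ a).hasFDerivAt.add_const (⟪a, b⟫_ℝ / 2))).const_mul Complex.I).cexp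
  have hshift : HasFDerivAt (fun q => φ (q + b)) (fderiv ℝ φ (q + b)) q :=
    (hasFDerivAt_comp_add_right b).2 (φ.hasFDerivAt (q + b))
  rw [funext (weylSchwartz_apply a b φ), (hphase.fun_mul hshift).fderiv]
  simp
  ring

theorem momAlong_weylSchwartz (u a b : V) (φ : 𝓢(V, ℂ)) :
    momAlong u (weylSchwartz a b φ) =
      weylSchwartz a b (momAlong u φ + (⟪u, a⟫_ℝ : ℂ) • φ) := by
  ext q
  rw [momAlong_apply, fderiv_weylSchwartz_apply, weylSchwartz_apply, add_apply, smul_apply,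
    momAlong_apply, real_inner_comm a u, smul_eq_mul]
  linear_combination (-(Complex.exp (Complex.I * ((⟪a, q⟫_ℝ + ⟪a, b⟫_ℝ / 2 : ℝ) : ℂ)) *
    (⟪a, u⟫_ℝ : ℂ) * φ (q + b))) * Complex.I_mul_I

end WeylSchwartz

section WeylCurves

variable {V : Type*} [NormedAddCommGroup V] [InnerProductSpace ℝ V]

theorem exists_one_add_norm_pow_mul_le {F : Type*} [NormedAddCommGroup F] [NormedSpace ℝ F]
    (f : 𝓢(V, F)) (k : ℕ) (M : ℝ) :
    ∃ K, ∀ q b : V, ‖b‖ ≤ M → (1 + ‖q‖) ^ k * ‖f (q + b)‖ ≤ K := by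
  obtain ⟨K, hK⟩ : ∃ K, ∀ y, (1 + ‖y‖) ^ k * ‖f y‖ ≤ K := ⟨_, fun y => by
    simpa only [norm_iteratedFDeriv_zero] using SchwartzMap.one_add_le_sup_seminorm_apply (𝕜 := ℝ)
      (m := (k, 0)) (k := k) (n := 0) le_rfl le_rfl f y⟩
  refine ⟨(1 + M) ^ k * K, fun q b hb => ?_⟩
  have hpeetre : 1 + ‖q‖ ≤ (1 + M) * (1 + ‖q + b‖) := by
    have hq : ‖q‖ ≤ ‖q + b‖ + ‖b‖ := by simpa using norm_sub_le (q + b) b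
    have hM : 0 ≤ M := (norm_nonneg b).trans hb
    nlinarith [mul_nonneg hM (norm_nonneg (q + b))]
  have hM : 0 ≤ 1 + M := by linarith [norm_nonneg b]
  calc (1 + ‖q‖) ^ k * ‖f (q + b)‖ ≤ ((1 + M) * (1 + ‖q + b‖)) ^ k * ‖f (q + b)‖ := by gcongr
    _ = (1 + M) ^ k * ((1 + ‖q + b‖) ^ k * ‖f (q + b)‖) := by rw [mul_pow, mul_assoc]
    _ ≤ (1 + M) ^ k * K := by gcongr; exact hK _

theorem hasDerivAt_weylSchwartz_apply {a b : ℝ → V} {a' b' : V} {s : ℝ}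
    (ha : HasDerivAt a a' s) (hb : HasDerivAt b b' s) (φ : 𝓢(V, ℂ)) (q : V) :
    HasDerivAt (fun s => weylSchwartz (a s) (b s) φ q)
      ((Complex.I • weylSchwartz (a s) (b s) (posAlong a' φ + momAlong b' φ +
        (((⟪a s, b'⟫_ℝ - ⟪a', b s⟫_ℝ) / 2 : ℝ) : ℂ) • φ)) q) s := by
  have hphase : HasDerivAt (fun s => ⟪a s, q⟫_ℝ + ⟪a s, b s⟫_ℝ / 2)
      (⟪a', q⟫_ℝ + (⟪a s, b'⟫_ℝ + ⟪a', b s⟫_ℝ) / 2) s := by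
    simpa [Pi.add_def] using
      (ha.inner ℝ (hasDerivAt_const s q)).add ((ha.inner ℝ hb).div_const 2)
  have hshift : HasDerivAt (fun s => φ (q + b s)) (fderiv ℝ φ (q + b s) b') s :=
    (φ.hasFDerivAt (q + b s)).comp_hasDerivAt s (hb.const_add q)
  simp only [weylSchwartz_apply]
  refine ((hphase.ofReal_comp.const_mul Complex.I).cexp.mul hshift).congr_deriv ?_
  simp only [smul_apply, weylSchwartz_apply, add_apply, posAlong_apply, momAlong_apply,
    smul_eq_mul, inner_add_right]
  push_cast
  linear_combination (Complex.exp (Complex.I * ((⟪a s, q⟫_ℝ : ℂ) + (⟪a s, b s⟫_ℝ : ℂ) / 2)) *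
    fderiv ℝ φ (q + b s) b') * Complex.I_mul_I

theorem norm_weylSchwartz_velocity_le {a b a' b' : V} {M : ℝ} (ha : ‖a‖ ≤ M) (hb : ‖b‖ ≤ M)
    (ha' : ‖a'‖ ≤ M) (hb' : ‖b'‖ ≤ M) (φ : 𝓢(V, ℂ)) (q : V) :
    ‖(Complex.I • weylSchwartz a b (posAlong a' φ + momAlong b' φ +
        (((⟪a, b'⟫_ℝ - ⟪a', b⟫_ℝ) / 2 : ℝ) : ℂ) • φ)) q‖ ≤
      (M + M ^ 2) * ((1 + ‖q + b‖) * ‖φ (q + b)‖ + ‖fderiv ℝ φ (q + b)‖) := by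
  have hM : 0 ≤ M := (norm_nonneg a).trans ha
  have hpos : |⟪a', q + b⟫_ℝ| ≤ M * ‖q + b‖ :=
    (abs_real_inner_le_norm _ _).trans (by gcongr)
  have hphase : |(⟪a, b'⟫_ℝ - ⟪a', b⟫_ℝ) / 2| ≤ M ^ 2 := by
    have h₁ : |⟪a, b'⟫_ℝ| ≤ M * M := (abs_real_inner_le_norm _ _).trans (by gcongr)
    have h₂ : |⟪a', b⟫_ℝ| ≤ M * M := (abs_real_inner_le_norm _ _).trans (by gcongr)
    rw [abs_div, abs_two, div_le_iff₀ two_pos]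
    linarith [abs_sub ⟪a, b'⟫_ℝ ⟪a', b⟫_ℝ]
  have hmom : ‖fderiv ℝ φ (q + b) b'‖ ≤ M * ‖fderiv ℝ φ (q + b)‖ :=
    (ContinuousLinearMap.le_opNorm _ _).trans (by rw [mul_comm]; gcongr)
  rw [smul_apply, norm_smul, Complex.norm_I, one_mul, norm_weylSchwartz_apply]
  simp only [add_apply, smul_apply, posAlong_apply, momAlong_apply, smul_eq_mul]
  calc _ ≤ |⟪a', q + b⟫_ℝ| * ‖φ (q + b)‖ + ‖fderiv ℝ φ (q + b) b'‖ +
        |(⟪a, b'⟫_ℝ - ⟪a', b⟫_ℝ) / 2| * ‖φ (q + b)‖ := by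
        refine norm_add₃_le.trans_eq ?_
        simp only [norm_mul, norm_neg, Complex.norm_I, one_mul, Complex.norm_real, Real.norm_eq_abs]
    _ ≤ M * ‖q + b‖ * ‖φ (q + b)‖ + M * ‖fderiv ℝ φ (q + b)‖ + M ^ 2 * ‖φ (q + b)‖ := by gcongr
    _ ≤ (M + M ^ 2) * ((1 + ‖q + b‖) * ‖φ (q + b)‖ + ‖fderiv ℝ φ (q + b)‖) := by
        have h₁ : 0 ≤ M * ‖φ (q + b)‖ := by positivity
        have h₂ : 0 ≤ M ^ 2 * (‖q + b‖ * ‖φ (q + b)‖) := by positivity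
        have h₃ : 0 ≤ M ^ 2 * ‖fderiv ℝ φ (q + b)‖ := by positivity
        linarith

variable [FiniteDimensional ℝ V] [MeasurableSpace V] [BorelSpace V]

theorem exists_integrable_sq_bound (φ : 𝓢(V, ℂ)) (M : ℝ) :
    ∃ g : V → ℝ, (Integrable fun q => g q ^ 2) ∧ ∀ q b : V, ‖b‖ ≤ M →
      (1 + ‖q + b‖) * ‖φ (q + b)‖ + ‖fderiv ℝ φ (q + b)‖ ≤ g q := by
  let N : ℕ := Module.finrank ℝ V + 1
  obtain ⟨K₀, hK₀⟩ := exists_one_add_norm_pow_mul_le φ (N + 1) M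
  obtain ⟨K₁, hK₁⟩ := exists_one_add_norm_pow_mul_le (SchwartzMap.fderivCLM ℝ V ℂ φ) N M
  simp only [SchwartzMap.fderivCLM_apply] at hK₁
  refine ⟨fun q => ((1 + |M|) * K₀ + K₁) / (1 + ‖q‖) ^ N, ?_, fun q b hb => ?_⟩
  · have hdecay : Integrable fun q : V => (1 + ‖q‖) ^ (-((2 * N : ℕ) : ℝ)) := by
      refine integrable_one_add_norm ?_
      rw [Nat.cast_lt]
      omega
    refine (hdecay.const_mul (((1 + |M|) * K₀ + K₁) ^ 2)).congr (Eventually.of_forall fun q => ?_)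
    beta_reduce
    rw [Real.rpow_neg (by positivity), Real.rpow_natCast, div_pow, pow_mul', div_eq_mul_inv]
  · have hy : 1 + ‖q + b‖ ≤ (1 + |M|) * (1 + ‖q‖) := by
      nlinarith [norm_add_le q b, hb.trans (le_abs_self M), abs_nonneg M,
        mul_nonneg (abs_nonneg M) (norm_nonneg q)]
    rw [le_div_iff₀ (by positivity)]
    calc ((1 + ‖q + b‖) * ‖φ (q + b)‖ + ‖fderiv ℝ φ (q + b)‖) * (1 + ‖q‖) ^ N
        ≤ ((1 + |M|) * (1 + ‖q‖) * ‖φ (q + b)‖ + ‖fderiv ℝ φ (q + b)‖) * (1 + ‖q‖) ^ N := by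
          gcongr
      _ = (1 + |M|) * ((1 + ‖q‖) ^ (N + 1) * ‖φ (q + b)‖) +
          (1 + ‖q‖) ^ N * ‖fderiv ℝ φ (q + b)‖ := by ring
      _ ≤ (1 + |M|) * K₀ + K₁ := by gcongr <;> [exact hK₀ q b hb; exact hK₁ q b hb]

theorem hasCurveDerivAt_toL2_weylSchwartz {a b a' b' : ℝ → V}
    (ha : ∀ s, HasDerivAt a (a' s) s) (hb : ∀ s, HasDerivAt b (b' s) s) (ha' : Continuous a')
    (hb' : Continuous b') (φ : 𝓢(V, ℂ)) (t : ℝ) :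
    HasCurveDerivAt (fun s => toL2 (weylSchwartz (a s) (b s) φ))
      (toL2 (Complex.I • weylSchwartz (a t) (b t) (posAlong (a' t) φ + momAlong (b' t) φ +
        (((⟪a t, b' t⟫_ℝ - ⟪a' t, b t⟫_ℝ) / 2 : ℝ) : ℂ) • φ))) t := by
  have hac : Continuous a := continuous_iff_continuousAt.2 fun s => (ha s).continuousAt
  have hbc : Continuous b := continuous_iff_continuousAt.2 fun s => (hb s).continuousAt
  obtain ⟨M, hM⟩ := (isCompact_closedBall t 1).exists_bound_of_continuousOn
    (f := fun s => (a s, b s, a' s, b' s)) (by fun_prop)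
  simp only [Prod.norm_def, max_le_iff] at hM
  obtain ⟨g, hg, hgb⟩ := exists_integrable_sq_bound φ M
  refine hasCurveDerivAt_toL2_of_dominated one_pos (D := fun s => Complex.I •
      weylSchwartz (a s) (b s) (posAlong (a' s) φ + momAlong (b' s) φ +
        (((⟪a s, b' s⟫_ℝ - ⟪a' s, b s⟫_ℝ) / 2 : ℝ) : ℂ) • φ))
    (fun q s _ => hasDerivAt_weylSchwartz_apply (ha s) (hb s) φ q)
    (g := fun q => (M + M ^ 2) * g q) (fun q s hs => ?_)
    (by simpa only [mul_pow] using hg.const_mul _)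
  obtain ⟨has, hbs, ha's, hb's⟩ := hM s (Metric.ball_subset_closedBall hs)
  have hM0 : 0 ≤ M := (norm_nonneg _).trans has
  refine (norm_weylSchwartz_velocity_le has hbs ha's hb's φ q).trans ?_
  gcongr
  exact hgb q (b s) hbs

end WeylCurves

section WeylL2

variable {V : Type*} [NormedAddCommGroup V] [InnerProductSpace ℝ V] [FiniteDimensional ℝ V]
  [MeasurableSpace V] [BorelSpace V]

/-- The Weyl operator `exp (i (Q(a) + P(b)))` on `L²`, as the extension of its explicit form on
Schwartz functions. -/
def weylL2 (a b : V) : Lp ℂ 2 (volume : Measure V) →L[ℂ] Lp ℂ 2 (volume : Measure V) :=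
  (toL2 ∘ₗ weylSchwartz a b).extendOfNorm toL2

theorem norm_toL2_weylSchwartz (a b : V) (φ : 𝓢(V, ℂ)) :
    ‖toL2 (weylSchwartz a b φ)‖ = ‖toL2 φ‖ := by
  refine (sq_eq_sq₀ (norm_nonneg _) (norm_nonneg _)).1 ?_
  simp only [norm_toL2_sq, norm_weylSchwartz_apply]
  exact integral_add_right_eq_self (fun q => ‖φ q‖ ^ 2) b

theorem weylL2_toL2 (a b : V) (φ : 𝓢(V, ℂ)) :
    weylL2 a b (toL2 φ) = toL2 (weylSchwartz a b φ) :=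
  LinearMap.extendOfNorm_eq denseRange_toL2
    ⟨1, fun φ => by rw [one_mul]; exact (norm_toL2_weylSchwartz a b φ).le⟩ φ

theorem norm_weylL2_apply (a b : V) (ψ : Lp ℂ 2 (volume : Measure V)) :
    ‖weylL2 a b ψ‖ = ‖ψ‖ := by
  refine denseRange_toL2.induction_on (p := fun ψ => ‖weylL2 a b ψ‖ = ‖ψ‖) ψ
    (isClosed_eq (by fun_prop) (by fun_prop)) fun φ => ?_
  rw [weylL2_toL2, norm_toL2_weylSchwartz]

theorem weylL2_mul (a b a' b' : V) :
    weylL2 a b * weylL2 a' b' =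
      Complex.exp (Complex.I * ((⟪a', b⟫_ℝ - ⟪a, b'⟫_ℝ : ℝ) / 2)) •
        weylL2 (a + a') (b + b') := by
  refine clm_ext_toL2 fun φ => ?_
  rw [mul_apply_eq_comp, smul_apply, weylL2_toL2, weylL2_toL2, weylL2_toL2, ← map_smul,
    weylSchwartz_weylSchwartz]

theorem weylL2_zero : weylL2 (0 : V) 0 = 1 := by
  refine clm_ext_toL2 fun φ => ?_
  rw [weylL2_toL2, weylSchwartz_zero, one_apply_eq_self]

theorem norm_weylL2_le_one (a b : V) : ‖weylL2 a b‖ ≤ 1 :=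
  ContinuousLinearMap.opNorm_le_bound _ zero_le_one fun ψ => by
    rw [norm_weylL2_apply, one_mul]

theorem weylL2_mul_eq_smul_mul (a b a' b' : V) :
    weylL2 a b * weylL2 a' b' = Complex.exp (Complex.I * ((⟪a', b⟫_ℝ - ⟪a, b'⟫_ℝ : ℝ) : ℂ)) •
      (weylL2 a' b' * weylL2 a b) := by
  rw [weylL2_mul, weylL2_mul, smul_smul, ← Complex.exp_add, add_comm a, add_comm b]
  congr 2
  push_cast
  ring

theorem norm_lie_weylL2_le (a b a' b' : V) :
    ‖⁅weylL2 a b, weylL2 a' b'⁆‖ ≤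
      ‖Complex.exp (Complex.I * ((⟪a', b⟫_ℝ - ⟪a, b'⟫_ℝ : ℝ) : ℂ)) - 1‖ := by
  have hprod : ‖weylL2 a' b' * weylL2 a b‖ ≤ 1 := (norm_mul_le _ _).trans
    (mul_le_one₀ (norm_weylL2_le_one _ _) (norm_nonneg _) (norm_weylL2_le_one _ _))
  rw [Ring.lie_def, weylL2_mul_eq_smul_mul, ← one_smul ℂ (weylL2 a' b' * weylL2 a b), smul_smul,
    mul_one, ← sub_smul]
  exact (norm_smul_le _ _).trans (mul_le_of_le_one_right (norm_nonneg _) hprod)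

theorem hasCurveDerivAt_weylL2_smul (a b : V) (φ : 𝓢(V, ℂ)) (t : ℝ) :
    HasCurveDerivAt (fun t : ℝ => weylL2 (t • a) (t • b) (toL2 φ))
      (Complex.I • weylL2 (t • a) (t • b) (toL2 (posAlong a φ + momAlong b φ))) t := by
  have h := hasCurveDerivAt_toL2_weylSchwartz
    (fun s => (hasDerivAt_id s).smul_const a) (fun s => (hasDerivAt_id s).smul_const b)
    continuous_const continuous_const φ t
  simpa [weylL2_toL2, inner_smul_left, inner_smul_right] using h

theorem isUnitaryGroup_weylL2_smul (a b : V) :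
    IsUnitaryGroup fun t : ℝ => weylL2 (t • a) (t • b) := by
  refine .of_norm_apply (fun t => norm_weylL2_apply _ _) ?_ (fun s t => ?_) denseRange_toL2 ?_
  · rw [zero_smul, zero_smul, weylL2_zero]
  · have hphase : ⟪t • a, s • b⟫_ℝ - ⟪s • a, t • b⟫_ℝ = 0 := by
      simp only [inner_smul_left, inner_smul_right, conj_trivial]
      ring
    simp [weylL2_mul, hphase, add_smul]
  · rintro _ ⟨φ, rfl⟩
    exact continuous_iff_continuousAt.2 fun t => (hasCurveDerivAt_weylL2_smul a b φ t).continuousAt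

theorem topologicalClosure_schwartzGraph_posAlong_add_momAlong (a b : V) :
    (schwartzGraph (posAlong a + momAlong b)).topologicalClosure =
      generator fun t : ℝ => weylL2 (t • a) (t • b) := by
  refine (isUnitaryGroup_weylL2_smul a b).topologicalClosure_eq_generator ?_ ?_
    (dense_fst_image_schwartzGraph _) le_rfl
    ((isSymmetricOp_posAlong a).add (isSymmetricOp_momAlong b)).isSymmetricRel_schwartzGraph
  · rintro _ ⟨φ, rfl⟩
    refine mem_generator.2 ?_
    simpa [weylL2_zero] using hasCurveDerivAt_weylL2_smul a b φ 0
  · rintro _ ⟨φ, rfl⟩ t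
    refine ⟨weylSchwartz (t • a) (t • b) φ, Prod.ext (weylL2_toL2 _ _ _).symm
      (.trans (congrArg toL2 ?_) (weylL2_toL2 _ _ _).symm)⟩
    rw [LinearMap.add_apply, posAlong_weylSchwartz, momAlong_weylSchwartz, ← map_add,
      inner_smul_right, inner_smul_right, real_inner_comm a b, LinearMap.add_apply]
    congr 1
    abel

end WeylL2

/-! ### Canonical commutation relations and ladder operators -/

section CommutationRelations

variable {V : Type*} [NormedAddCommGroup V] [InnerProductSpace ℝ V]

theorem commute_posAlong (a b : V) : Commute (posAlong a) (posAlong b) := by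
  ext φ q
  simp only [Module.End.mul_apply, posAlong_apply, mul_left_comm]

theorem momAlong_momAlong_apply (a b : V) (φ : 𝓢(V, ℂ)) (q : V) :
    momAlong a (momAlong b φ) q = -fderiv ℝ (fderiv ℝ φ) q a b := by
  have hd : HasFDerivAt (fderiv ℝ φ) (fderiv ℝ (fderiv ℝ φ) q) q :=
    (((φ.smooth 2).fderiv_right (m := 1) le_rfl).differentiable one_ne_zero q).hasFDerivAt
  have hb := (hd.clm_apply (hasFDerivAt_const b q)).const_mul (-Complex.I)
  rw [momAlong_apply, funext (momAlong_apply b φ), hb.fderiv]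
  simp [← mul_assoc]

theorem commute_momAlong (a b : V) : Commute (momAlong a) (momAlong b) := by
  ext φ q
  have hsymm : IsSymmSndFDerivAt ℝ φ q := (φ.smooth 2).contDiffAt.isSymmSndFDerivAt (by simp)
  rw [Module.End.mul_apply, Module.End.mul_apply, momAlong_momAlong_apply,
    momAlong_momAlong_apply, hsymm.eq]

theorem posAlong_mul_momAlong (a b : V) :
    posAlong a * momAlong b = momAlong b * posAlong a + (Complex.I * (⟪a, b⟫_ℝ : ℂ)) • 1 := by
  ext φ q
  have hprod : HasFDerivAt (fun q => (⟪a, q⟫_ℝ : ℂ) * φ q)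
      ((⟪a, q⟫_ℝ : ℂ) • fderiv ℝ φ q + φ q • Complex.ofRealCLM.comp (innerSL ℝ a)) q :=
    (Complex.ofRealCLM.comp (innerSL ℝ a)).hasFDerivAt.mul (φ.hasFDerivAt q)
  rw [LinearMap.add_apply, Module.End.mul_apply, Module.End.mul_apply, add_apply,
    posAlong_apply, momAlong_apply, momAlong_apply, funext (posAlong_apply a φ), hprod.fderiv]
  simp
  ring

end CommutationRelations

/-- Normal modes of an oscillator: dual bases `pos` and `mom` of `V` with positive frequencies
`freq`. The functions `⟪pos j, q⟫` are the normal coordinates, and `-i ∂_{mom j}` the conjugate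
momenta. -/
structure NormalModes (ι V : Type*) [Fintype ι] [DecidableEq ι] [NormedAddCommGroup V]
    [InnerProductSpace ℝ V] where
  pos : ι → V
  mom : ι → V
  freq : ι → ℝ
  freq_pos : ∀ j, 0 < freq j
  inner_pos_mom : ∀ j k, ⟪pos j, mom k⟫_ℝ = if j = k then 1 else 0
  sum_inner_mom_smul_pos : ∀ a, ∑ j, ⟪mom j, a⟫_ℝ • pos j = a

namespace NormalModes

section Ladder

variable {ι V : Type*} [Fintype ι] [DecidableEq ι] [NormedAddCommGroup V] [InnerProductSpace ℝ V]
  (M : NormalModes ι V)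

theorem sum_inner_pos_smul_mom (b : V) : ∑ j, ⟪M.pos j, b⟫_ℝ • M.mom j = b := by
  refine ext_inner_right ℝ fun a => ?_
  conv_rhs => rw [← M.sum_inner_mom_smul_pos a]
  simp only [sum_inner, inner_sum, inner_smul_left, inner_smul_right, conj_trivial]
  exact Finset.sum_congr rfl fun j _ => by rw [real_inner_comm b, mul_comm]

/-- The Hamiltonian `∑ j, (-∂²_{mom j} + freq j ² ⟪pos j, q⟫²)` on Schwartz functions. -/
def oscillator : Module.End ℂ 𝓢(V, ℂ) :=
  ∑ j, (momAlong (M.mom j) ^ 2 + ((M.freq j ^ 2 : ℝ) : ℂ) • posAlong (M.pos j) ^ 2)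

/-- The raising operator (unnormalized creation operator) of a mode. -/
def raise (j : ι) : Module.End ℂ 𝓢(V, ℂ) :=
  (M.freq j : ℂ) • posAlong (M.pos j) - Complex.I • momAlong (M.mom j)

/-- The lowering operator (unnormalized annihilation operator) of a mode. -/
def lower (j : ι) : Module.End ℂ 𝓢(V, ℂ) :=
  (M.freq j : ℂ) • posAlong (M.pos j) + Complex.I • momAlong (M.mom j)

theorem posAlong_mul_momAlong (j k : ι) :
    posAlong (M.pos j) * momAlong (M.mom k) =
      momAlong (M.mom k) * posAlong (M.pos j) + (if j = k then Complex.I else 0) • 1 := by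
  rw [OscillatorSystem.posAlong_mul_momAlong, M.inner_pos_mom]
  split_ifs <;> simp

theorem lower_mul_raise (j k : ι) :
    M.lower j * M.raise k =
      M.raise k * M.lower j + (if j = k then (2 * M.freq k : ℂ) else 0) • 1 := by
  simp only [lower, raise, add_mul, sub_mul, mul_add, mul_sub, smul_mul_smul_comm,
    M.posAlong_mul_momAlong, (commute_posAlong (M.pos j) (M.pos k)).eq,
    (commute_momAlong (M.mom j) (M.mom k)).eq]
  rcases eq_or_ne j k with rfl | hjk
  · simp only [if_true]
    match_scalars <;> first | ring1 | linear_combination (-2 * (M.freq j : ℂ)) * Complex.I_mul_I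
  · simp only [if_neg hjk, if_neg hjk.symm]
    module

theorem commute_raise (j k : ι) : Commute (M.raise j) (M.raise k) := by
  rw [commute_iff_eq]
  simp only [raise, sub_mul, mul_sub, smul_mul_smul_comm, M.posAlong_mul_momAlong,
    (commute_posAlong (M.pos j) (M.pos k)).eq, (commute_momAlong (M.mom j) (M.mom k)).eq]
  rcases eq_or_ne j k with rfl | hjk
  · rfl
  · simp only [if_neg hjk, if_neg hjk.symm]
    module

theorem raise_mul_lower (j : ι) :
    M.raise j * M.lower j = momAlong (M.mom j) ^ 2 +
      ((M.freq j ^ 2 : ℝ) : ℂ) • posAlong (M.pos j) ^ 2 - (M.freq j : ℂ) • 1 := by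
  simp only [raise, lower, sub_mul, mul_add, smul_mul_smul_comm, M.posAlong_mul_momAlong,
    if_true, pow_two]
  match_scalars <;> first
    | ring1
    | linear_combination (M.freq j : ℂ) * Complex.I_mul_I
    | linear_combination -Complex.I_mul_I

theorem oscillator_eq_sum_raise_mul_lower :
    M.oscillator = ∑ j, (M.raise j * M.lower j + (M.freq j : ℂ) • 1) :=
  Finset.sum_congr rfl fun j _ => by rw [M.raise_mul_lower, sub_add_cancel]

theorem oscillator_mul_raise (k : ι) :
    M.oscillator * M.raise k = M.raise k * M.oscillator + (2 * M.freq k : ℂ) • M.raise k := by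
  have hmode (j : ι) : (M.raise j * M.lower j + (M.freq j : ℂ) • 1) * M.raise k =
      M.raise k * (M.raise j * M.lower j + (M.freq j : ℂ) • 1) +
        if j = k then (2 * M.freq k : ℂ) • M.raise k else 0 := by
    rw [add_mul, mul_assoc, M.lower_mul_raise, mul_add, ← mul_assoc, (M.commute_raise j k).eq]
    split_ifs with hjk
    · subst hjk
      simp only [mul_add, mul_assoc, mul_smul_comm, smul_mul_assoc, one_mul, mul_one]
      abel
    · simp only [mul_add, mul_assoc, mul_smul_comm, smul_mul_assoc, one_mul, mul_one, zero_smul,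
        mul_zero, add_zero]
  rw [oscillator_eq_sum_raise_mul_lower, Finset.sum_mul, Finset.mul_sum,
    Finset.sum_congr rfl fun j _ => hmode j, Finset.sum_add_distrib, Finset.sum_ite_eq',
    if_pos (Finset.mem_univ k)]

theorem posAlong_pos (j : ι) :
    posAlong (M.pos j) = (2 * M.freq j : ℂ)⁻¹ • (M.raise j + M.lower j) := by
  have hfreq : (M.freq j : ℂ) ≠ 0 := by exact_mod_cast (M.freq_pos j).ne'
  rw [raise, lower]
  match_scalars
  · field_simp
    norm_num
  · ring

end Ladder

end NormalModes

/-! ### Gaussians and the completeness of their moments -/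

section ExpSchwartz

theorem exists_one_add_pow_mul_exp_neg_sq_le (N : ℕ) {ε : ℝ} (hε : 0 < ε) :
    ∃ C : ℝ, ∀ s : ℝ, 0 ≤ s → (1 + s) ^ N * Real.exp (-ε * s ^ 2) ≤ C := by
  refine ⟨N.factorial * Real.exp (1 + 1 / (4 * ε)), fun s hs => ?_⟩
  have hpow : (1 + s) ^ N ≤ N.factorial * Real.exp (1 + s) := by
    have := Real.pow_div_factorial_le_exp (1 + s) (by positivity) N
    rwa [div_le_iff₀' (by positivity)] at this
  have hsquare : s - ε * s ^ 2 = 1 / (4 * ε) - ε * (s - 1 / (2 * ε)) ^ 2 := by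
    field_simp
    ring
  calc (1 + s) ^ N * Real.exp (-ε * s ^ 2)
      ≤ N.factorial * Real.exp (1 + s) * Real.exp (-ε * s ^ 2) := by gcongr
    _ = N.factorial * Real.exp (1 + (s - ε * s ^ 2)) := by
        rw [mul_assoc, ← Real.exp_add]
        ring_nf
    _ ≤ N.factorial * Real.exp (1 + 1 / (4 * ε)) := by
        rw [hsquare]
        gcongr
        exact sub_le_self _ (by positivity)

variable {V : Type*} [NormedAddCommGroup V] [NormedSpace ℝ V]

theorem exists_norm_iteratedFDeriv_exp_comp_le {f : V → ℝ} (hf : f.HasTemperateGrowth) (n : ℕ) :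
    ∃ (C : ℝ) (m : ℕ), 0 ≤ C ∧ ∀ x,
      ‖iteratedFDeriv ℝ n (Real.exp ∘ f) x‖ ≤ C * (1 + ‖x‖) ^ m * Real.exp (f x) := by
  obtain ⟨m, C, hC, hCf⟩ := hf.norm_iteratedFDeriv_le_uniform n
  refine ⟨n.factorial * (C + 1) ^ n, m * n, by positivity, fun x => ?_⟩
  have hone : (1 : ℝ) ≤ (1 + ‖x‖) ^ m := one_le_pow₀ (by linarith [norm_nonneg x])
  have hD : 1 ≤ (C + 1) * (1 + ‖x‖) ^ m := one_le_mul_of_one_le_of_one_le (by linarith) hone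
  calc ‖iteratedFDeriv ℝ n (Real.exp ∘ f) x‖
      ≤ n.factorial * Real.exp (f x) * ((C + 1) * (1 + ‖x‖) ^ m) ^ n := by
        refine norm_iteratedFDeriv_comp_le (N := ((⊤ : ℕ∞) : WithTop ℕ∞)) Real.contDiff_exp hf.1
          (by exact_mod_cast le_top) x (fun i _ => ?_) (fun i hi hin => ?_)
        · rw [norm_iteratedFDeriv_eq_norm_iteratedDeriv, iteratedDeriv_eq_iterate,
            Real.iter_deriv_exp, Real.norm_eq_abs, Real.abs_exp]
        · calc ‖iteratedFDeriv ℝ i f x‖ ≤ C * (1 + ‖x‖) ^ m := hCf i hin x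
            _ ≤ (C + 1) * (1 + ‖x‖) ^ m := by gcongr; linarith
            _ ≤ ((C + 1) * (1 + ‖x‖) ^ m) ^ i := le_self_pow₀ hD (by omega)
    _ = n.factorial * (C + 1) ^ n * (1 + ‖x‖) ^ (m * n) * Real.exp (f x) := by
        rw [mul_pow, pow_mul]
        ring

/-- The Schwartz function `exp ∘ f`, for `f` of temperate growth with `f x ≤ -ε ‖x‖²`. -/
def expSchwartz (f : V → ℝ) (hf : f.HasTemperateGrowth) {ε : ℝ} (hε : 0 < ε)
    (hle : ∀ x, f x ≤ -ε * ‖x‖ ^ 2) : 𝓢(V, ℝ) where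
  toFun := Real.exp ∘ f
  smooth' := Real.contDiff_exp.comp hf.1
  decay' k n := by
    obtain ⟨C, m, hC, hbound⟩ := exists_norm_iteratedFDeriv_exp_comp_le hf n
    obtain ⟨K, hK⟩ := exists_one_add_pow_mul_exp_neg_sq_le (k + m) hε
    refine ⟨C * K, fun x => ?_⟩
    calc ‖x‖ ^ k * ‖iteratedFDeriv ℝ n (Real.exp ∘ f) x‖
        ≤ (1 + ‖x‖) ^ k * (C * (1 + ‖x‖) ^ m * Real.exp (-ε * ‖x‖ ^ 2)) := by
          gcongr
          · linarith
          · refine (hbound x).trans ?_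
            gcongr
            exact hle x
      _ = C * ((1 + ‖x‖) ^ (k + m) * Real.exp (-ε * ‖x‖ ^ 2)) := by
          rw [pow_add]
          ring
      _ ≤ C * K := by
          gcongr
          exact hK _ (norm_nonneg _)

theorem expSchwartz_apply (f : V → ℝ) (hf : f.HasTemperateGrowth) {ε : ℝ} (hε : 0 < ε)
    (hle : ∀ x, f x ≤ -ε * ‖x‖ ^ 2) (x : V) : expSchwartz f hf hε hle x = Real.exp (f x) :=
  rfl

end ExpSchwartz

section Moments

open FourierTransform

variable {V : Type*} [NormedAddCommGroup V] [InnerProductSpace ℝ V] [FiniteDimensional ℝ V]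
  [MeasurableSpace V] [BorelSpace V]

theorem ae_eq_zero_of_fourier_eq_zero {F : V → ℂ} (hF : Integrable F) (h : ∀ w, 𝓕 F w = 0) :
    ∀ᵐ q, F q = 0 := by
  refine ae_eq_zero_of_integral_contDiff_smul_eq_zero hF.locallyIntegrable fun g hg hgs => ?_
  let G : 𝓢(V, ℂ) := (hgs.comp_left Complex.ofReal_zero).toSchwartzMap
    (Complex.ofRealCLM.contDiff.comp hg)
  have hflip := VectorFourier.integral_fourierIntegral_smul_eq_flip (L := innerₗ V)
    (μ := volume) (ν := volume) Real.continuous_fourierChar continuous_inner (𝓕⁻ G).integrable hF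
  have hinv (x : V) : 𝓕 ((𝓕⁻ G : 𝓢(V, ℂ)) : V → ℂ) x = g x := by
    rw [← SchwartzMap.fourier_coe, FourierTransform.fourier_fourierInv_eq]
    rfl
  calc ∫ x, g x • F x
      = ∫ x, 𝓕 ((𝓕⁻ G : 𝓢(V, ℂ)) : V → ℂ) x • F x := by
        simp only [hinv, Complex.real_smul, smul_eq_mul]
    _ = ∫ x, (𝓕⁻ G : 𝓢(V, ℂ)) x • 𝓕 F x := by simpa using! hflip
    _ = 0 := by simp only [h, smul_zero, integral_zero]

theorem integral_cexp_mul_eq_zero_of_moments_eq_zero {F : V → ℂ} (hF : AEStronglyMeasurable F)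
    {a : V} (hintegrable : Integrable fun q => Real.exp |⟪a, q⟫_ℝ| * ‖F q‖)
    (h : ∀ n : ℕ, ∫ q, (⟪a, q⟫_ℝ : ℂ) ^ n * F q = 0) :
    ∫ q, Complex.exp (Complex.I * (⟪a, q⟫_ℝ : ℂ)) * F q = 0 := by
  have hexp (x : ℝ) : HasSum (fun n : ℕ => x ^ n / n.factorial) (Real.exp x) := by
    rw [Real.exp_eq_exp_ℝ]
    exact NormedSpace.expSeries_div_hasSum_exp x
  have hcexp (z : ℂ) : HasSum (fun n : ℕ => z ^ n / n.factorial) (Complex.exp z) := by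
    rw [Complex.exp_eq_exp_ℂ]
    exact NormedSpace.expSeries_div_hasSum_exp z
  have hsum := hasSum_integral_of_dominated_convergence (μ := (volume : Measure V))
    (F := fun (n : ℕ) q => (Complex.I * (⟪a, q⟫_ℝ : ℂ)) ^ n / n.factorial * F q)
    (f := fun q => Complex.exp (Complex.I * (⟪a, q⟫_ℝ : ℂ)) * F q)
    (fun n q => |⟪a, q⟫_ℝ| ^ n / n.factorial * ‖F q‖)
    (fun n => (Continuous.aestronglyMeasurable (by fun_prop)).mul hF)
    (fun n => .of_forall fun q => by simp)
    (.of_forall fun q => ((hexp |⟪a, q⟫_ℝ|).mul_right ‖F q‖).summable)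
    (hintegrable.congr (.of_forall fun q => ((hexp |⟪a, q⟫_ℝ|).mul_right ‖F q‖).tsum_eq.symm))
    (.of_forall fun q => (hcexp _).mul_right _)
  have hzero (n : ℕ) : ∫ q, (Complex.I * (⟪a, q⟫_ℝ : ℂ)) ^ n / n.factorial * F q = 0 := by
    simp only [mul_pow, mul_div_right_comm, mul_assoc]
    rw [integral_const_mul, h n, mul_zero]
  simp only [hzero] at hsum
  exact hsum.unique hasSum_zero

theorem ae_eq_zero_of_moments_eq_zero {F : V → ℂ} (hF : AEStronglyMeasurable F)
    (hintegrable : ∀ a : V, Integrable fun q => Real.exp |⟪a, q⟫_ℝ| * ‖F q‖)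
    (h : ∀ (a : V) (n : ℕ), ∫ q, (⟪a, q⟫_ℝ : ℂ) ^ n * F q = 0) : ∀ᵐ q, F q = 0 := by
  have hF' : Integrable F := (integrable_norm_iff hF).1 (by simpa using hintegrable 0)
  refine ae_eq_zero_of_fourier_eq_zero hF' fun w => ?_
  rw [Real.fourier_eq', ← integral_cexp_mul_eq_zero_of_moments_eq_zero hF
    (hintegrable ((-2 * Real.pi) • w)) (h _)]
  refine integral_congr_ae (.of_forall fun q => ?_)
  simp only [smul_eq_mul, inner_smul_left, conj_trivial, real_inner_comm w q]
  push_cast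
  ring_nf

end Moments

/-! ### Eigenfunctions of an oscillator -/

namespace NormalModes

section Ground

variable {ι V : Type*} [Fintype ι] [DecidableEq ι] [NormedAddCommGroup V] [InnerProductSpace ℝ V]
  (M : NormalModes ι V)

/-- The exponent of the Gaussian ground state. -/
def groundExponent (q : V) : ℝ :=
  -(1 / 2) * ∑ j, M.freq j * ⟪M.pos j, q⟫_ℝ ^ 2

theorem hasTemperateGrowth_groundExponent : M.groundExponent.HasTemperateGrowth :=
  (Function.HasTemperateGrowth.const _).mul <| .sum fun j _ =>
    (Function.HasTemperateGrowth.const _).mul ((innerSL ℝ (M.pos j)).hasTemperateGrowth.pow 2)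

theorem hasFDerivAt_groundExponent (q : V) :
    HasFDerivAt M.groundExponent
      (-innerSL ℝ (∑ j, (M.freq j * ⟪M.pos j, q⟫_ℝ) • M.pos j)) q := by
  have hsq (j : ι) : HasFDerivAt (fun q => M.freq j * ⟪M.pos j, q⟫_ℝ ^ 2)
      (M.freq j • (2 * ⟪M.pos j, q⟫_ℝ) • innerSL ℝ (M.pos j)) q := by
    simpa using (((innerSL ℝ (M.pos j)).hasFDerivAt (x := q)).pow 2).const_mul (M.freq j)
  refine ((HasFDerivAt.fun_sum fun j _ => hsq j).const_mul (-(1 / 2))).congr_fderiv ?_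
  ext v
  simp only [smul_apply, sum_apply, neg_apply, innerSL_apply_apply, sum_inner, inner_smul_left,
    conj_trivial, smul_eq_mul, Finset.mul_sum, ← Finset.sum_neg_distrib]
  exact Finset.sum_congr rfl fun j _ => by ring

theorem norm_sq_le (q : V) :
    ‖q‖ ^ 2 ≤ (∑ j, ‖M.mom j‖ ^ 2 / M.freq j) * ∑ j, M.freq j * ⟪M.pos j, q⟫_ℝ ^ 2 := by
  have hnorm : ‖q‖ ≤ ∑ j, (‖M.mom j‖ / √(M.freq j)) * (√(M.freq j) * |⟪M.pos j, q⟫_ℝ|) := by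
    conv_lhs => rw [← M.sum_inner_pos_smul_mom q]
    refine (norm_sum_le _ _).trans_eq (Finset.sum_congr rfl fun j _ => ?_)
    have : √(M.freq j) ≠ 0 := (Real.sqrt_pos.2 (M.freq_pos j)).ne'
    rw [norm_smul, Real.norm_eq_abs, ← mul_assoc, div_mul_cancel₀ _ this, mul_comm]
  calc ‖q‖ ^ 2
      ≤ (∑ j, (‖M.mom j‖ / √(M.freq j)) * (√(M.freq j) * |⟪M.pos j, q⟫_ℝ|)) ^ 2 := by gcongr
    _ ≤ (∑ j, (‖M.mom j‖ / √(M.freq j)) ^ 2) * ∑ j, (√(M.freq j) * |⟪M.pos j, q⟫_ℝ|) ^ 2 :=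
        Finset.sum_mul_sq_le_sq_mul_sq _ _ _
    _ = _ := by simp only [div_pow, mul_pow, sq_abs, Real.sq_sqrt (M.freq_pos _).le]

theorem exists_groundExponent_le : ∃ ε > 0, ∀ q, M.groundExponent q ≤ -ε * ‖q‖ ^ 2 := by
  set K := ∑ j, ‖M.mom j‖ ^ 2 / M.freq j
  have hK : 0 ≤ K := Finset.sum_nonneg fun j _ => div_nonneg (sq_nonneg _) (M.freq_pos j).le
  refine ⟨1 / (2 * (K + 1)), by positivity, fun q => ?_⟩
  have hS : 0 ≤ ∑ j, M.freq j * ⟪M.pos j, q⟫_ℝ ^ 2 :=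
    Finset.sum_nonneg fun j _ => mul_nonneg (M.freq_pos j).le (sq_nonneg _)
  have hq : ‖q‖ ^ 2 / (K + 1) ≤ ∑ j, M.freq j * ⟪M.pos j, q⟫_ℝ ^ 2 := by
    rw [div_le_iff₀' (by positivity), add_one_mul]
    exact (M.norm_sq_le q).trans (le_add_of_nonneg_right hS)
  calc M.groundExponent q ≤ -(1 / 2) * (‖q‖ ^ 2 / (K + 1)) :=
        mul_le_mul_of_nonpos_left hq (by norm_num)
    _ = -(1 / (2 * (K + 1))) * ‖q‖ ^ 2 := by
        field_simp

/-- The ground state. -/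
def ground : 𝓢(V, ℂ) :=
  SchwartzMap.postcompCLM Complex.ofRealCLM
    (expSchwartz M.groundExponent M.hasTemperateGrowth_groundExponent
      M.exists_groundExponent_le.choose_spec.1 M.exists_groundExponent_le.choose_spec.2)

theorem ground_apply (q : V) : M.ground q = Real.exp (M.groundExponent q) := rfl

theorem momAlong_ground (b q : V) :
    momAlong b M.ground q =
      Complex.I * ((∑ j, M.freq j * ⟪M.pos j, q⟫_ℝ * ⟪M.pos j, b⟫_ℝ : ℝ) : ℂ) * M.ground q := by
  have hexp : HasFDerivAt M.ground _ q :=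
    Complex.ofRealCLM.hasFDerivAt.comp q (M.hasFDerivAt_groundExponent q).exp
  rw [momAlong_apply, hexp.fderiv, ground_apply]
  simp
  ring

theorem lower_ground (k : ι) : M.lower k M.ground = 0 := by
  ext q
  rw [lower, LinearMap.add_apply, LinearMap.smul_apply, LinearMap.smul_apply, add_apply,
    smul_apply, smul_apply, momAlong_ground, posAlong_apply]
  simp only [M.inner_pos_mom, mul_ite, mul_one, mul_zero, Finset.sum_ite_eq', Finset.mem_univ,
    if_true, smul_eq_mul, zero_apply]
  push_cast
  linear_combination (M.freq k * ⟪M.pos k, q⟫_ℝ * M.ground q : ℂ) * Complex.I_mul_I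

/-- The excited states, indexed by the list of quanta; they are unnormalized eigenfunctions. -/
def excited : List ι → 𝓢(V, ℂ)
  | [] => M.ground
  | j :: l => M.raise j (excited l)

/-- The energy of the excited state with the given list of quanta. -/
def energy (l : List ι) : ℝ :=
  ∑ j, M.freq j + 2 * (l.map M.freq).sum

theorem oscillator_excited (l : List ι) :
    M.oscillator (M.excited l) = (M.energy l : ℂ) • M.excited l := by
  induction l with
  | nil =>
    simp [oscillator_eq_sum_raise_mul_lower, excited, energy, lower_ground, Finset.sum_smul]
  | cons j l ih =>
    rw [excited, ← Module.End.mul_apply, oscillator_mul_raise, LinearMap.add_apply,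
      Module.End.mul_apply, ih, map_smul, LinearMap.smul_apply, ← add_smul]
    congr 1
    simp only [energy, List.map_cons, List.sum_cons]
    push_cast
    ring

theorem raise_mem_span_excited (k : ι) {φ : 𝓢(V, ℂ)}
    (hφ : φ ∈ Submodule.span ℂ (Set.range M.excited)) :
    M.raise k φ ∈ Submodule.span ℂ (Set.range M.excited) := by
  suffices Submodule.span ℂ (Set.range M.excited) ≤
    (Submodule.span ℂ (Set.range M.excited)).comap (M.raise k) from this hφ
  rw [Submodule.span_le]
  rintro _ ⟨l, rfl⟩
  exact Submodule.subset_span ⟨k :: l, rfl⟩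

theorem lower_mem_span_excited (k : ι) {φ : 𝓢(V, ℂ)}
    (hφ : φ ∈ Submodule.span ℂ (Set.range M.excited)) :
    M.lower k φ ∈ Submodule.span ℂ (Set.range M.excited) := by
  suffices Submodule.span ℂ (Set.range M.excited) ≤
    (Submodule.span ℂ (Set.range M.excited)).comap (M.lower k) from this hφ
  rw [Submodule.span_le]
  rintro _ ⟨l, rfl⟩
  rw [SetLike.mem_coe, Submodule.mem_comap]
  induction l with
  | nil => rw [excited, lower_ground]; exact zero_mem _
  | cons j l ih =>
    rw [excited, ← Module.End.mul_apply, lower_mul_raise, LinearMap.add_apply]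
    exact add_mem (M.raise_mem_span_excited j ih)
      (Submodule.smul_mem _ _ (Submodule.subset_span ⟨l, rfl⟩))

theorem posAlong_mem_span_excited (a : V) {φ : 𝓢(V, ℂ)}
    (hφ : φ ∈ Submodule.span ℂ (Set.range M.excited)) :
    posAlong a φ ∈ Submodule.span ℂ (Set.range M.excited) := by
  rw [← M.sum_inner_mom_smul_pos a, posAlong_sum_smul, LinearMap.sum_apply]
  refine sum_mem fun j _ => Submodule.smul_mem _ _ ?_
  rw [M.posAlong_pos]
  exact Submodule.smul_mem _ _
    (add_mem (M.raise_mem_span_excited j hφ) (M.lower_mem_span_excited j hφ))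

theorem posAlong_pow_ground_mem_span_excited (a : V) (n : ℕ) :
    (posAlong a ^ n) M.ground ∈ Submodule.span ℂ (Set.range M.excited) := by
  induction n with
  | zero => exact Submodule.subset_span ⟨[], rfl⟩
  | succ n ih => rw [pow_succ']; exact M.posAlong_mem_span_excited a ih

end Ground

section Completeness

variable {ι V : Type*} [Fintype ι] [DecidableEq ι] [NormedAddCommGroup V] [InnerProductSpace ℝ V]
  [FiniteDimensional ℝ V] [MeasurableSpace V] [BorelSpace V] (M : NormalModes ι V)

theorem memLp_exp_mul_ground (a : V) :
    MemLp (fun q => Real.exp |⟪a, q⟫_ℝ| * Real.exp (M.groundExponent q)) 2 := by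
  obtain ⟨ε, hε, hle⟩ := M.exists_groundExponent_le
  have hsq : Function.HasTemperateGrowth fun q : V => -(ε / 2) * ‖q‖ ^ 2 :=
    (Function.HasTemperateGrowth.const _).mul (Function.hasTemperateGrowth_norm_sq _)
  have hgauss := (expSchwartz _ hsq (half_pos hε) fun _ => le_rfl).memLp 2 volume
  have hcont : Continuous M.groundExponent := M.hasTemperateGrowth_groundExponent.1.continuous
  refine (hgauss.const_mul (Real.exp (‖a‖ ^ 2 / (2 * ε)))).mono
    (Continuous.aestronglyMeasurable (by fun_prop)) (.of_forall fun q => ?_)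
  have hyoung : ‖a‖ * ‖q‖ ≤ ‖a‖ ^ 2 / (2 * ε) + ε / 2 * ‖q‖ ^ 2 := by
    have hsquare : ‖a‖ ^ 2 / (2 * ε) + ε / 2 * ‖q‖ ^ 2 - ‖a‖ * ‖q‖ =
        (‖a‖ - ε * ‖q‖) ^ 2 / (2 * ε) := by
      field_simp
      ring
    rw [← sub_nonneg, hsquare]
    positivity
  rw [expSchwartz_apply, ← Real.exp_add, ← Real.exp_add, Real.norm_eq_abs, Real.norm_eq_abs,
    Real.abs_exp, Real.abs_exp, Real.exp_le_exp]
  linarith [abs_real_inner_le_norm a q, hle q]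

theorem integral_moment_ground_mul (a : V) (n : ℕ) (ψ : Lp ℂ 2 (volume : Measure V)) :
    ∫ q, (⟪a, q⟫_ℝ : ℂ) ^ n * (M.ground q * ψ q) = ⟪toL2 ((posAlong a ^ n) M.ground), ψ⟫_ℂ := by
  rw [L2.inner_def]
  refine integral_congr_ae ?_
  filter_upwards [((posAlong a ^ n) M.ground).coeFn_toLp 2 volume] with q hq
  rw [show (toL2 ((posAlong a ^ n) M.ground) : V → ℂ) q = _ from hq, posAlong_pow_apply,
    RCLike.inner_apply', map_mul, map_pow, Complex.conj_ofReal, ground_apply,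
    Complex.conj_ofReal, mul_assoc]

theorem dense_span_excited :
    Dense (Submodule.span ℂ (Set.range fun l => toL2 (M.excited l)) :
      Set (Lp ℂ 2 (volume : Measure V))) := by
  rw [Submodule.dense_iff_topologicalClosure_eq_top, Submodule.topologicalClosure_eq_top_iff,
    Submodule.eq_bot_iff]
  intro ψ hψ
  have horth {φ : 𝓢(V, ℂ)} (hφ : φ ∈ Submodule.span ℂ (Set.range M.excited)) :
      ⟪toL2 φ, ψ⟫_ℂ = 0 := by
    refine hψ (toL2 φ) ?_
    have := Submodule.mem_map_of_mem (f := toL2) hφ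
    rwa [Submodule.map_span, ← Set.range_comp] at this
  have hψ2 : MemLp ψ 2 := Lp.memLp ψ
  have hzero : ∀ᵐ q, M.ground q * ψ q = 0 := by
    refine ae_eq_zero_of_moments_eq_zero
      (M.ground.continuous.aestronglyMeasurable.mul hψ2.aestronglyMeasurable) (fun a => ?_)
      fun a n => by
        rw [integral_moment_ground_mul, horth (M.posAlong_pow_ground_mem_span_excited a n)]
    refine ((M.memLp_exp_mul_ground a).integrable_mul hψ2.norm).congr (.of_forall fun q => ?_)
    simp only [Pi.mul_apply, norm_mul, ground_apply, Complex.norm_real, Real.norm_eq_abs,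
      Real.abs_exp, mul_assoc]
  rw [Lp.eq_zero_iff_ae_eq_zero]
  filter_upwards [hzero] with q hq
  refine (mul_eq_zero.1 hq).resolve_left ?_
  rw [ground_apply]
  exact_mod_cast (Real.exp_pos _).ne'

end Completeness

end NormalModes

/-! ### The oscillator dynamics of Weyl operators -/

namespace NormalModes

section Flow

variable {ι V : Type*} [Fintype ι] [DecidableEq ι] [NormedAddCommGroup V] [InnerProductSpace ℝ V]
  (M : NormalModes ι V)

theorem inner_mom_sum_smul_pos (α : ι → ℝ) (k : ι) : ⟪M.mom k, ∑ j, α j • M.pos j⟫_ℝ = α k := by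
  rw [real_inner_comm, sum_inner]
  simp [real_inner_smul_left, M.inner_pos_mom]

theorem inner_pos_sum_smul_mom (β : ι → ℝ) (k : ι) : ⟪M.pos k, ∑ j, β j • M.mom j⟫_ℝ = β k := by
  simp [inner_sum, real_inner_smul_right, M.inner_pos_mom]

/-- The coefficient along `pos j` of the position vector evolved from `(a, b)`. -/
def posCoeff (a b : V) (t : ℝ) (j : ι) : ℝ :=
  Real.cos (2 * M.freq j * t) * ⟪M.mom j, a⟫_ℝ -
    M.freq j * Real.sin (2 * M.freq j * t) * ⟪M.pos j, b⟫_ℝ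

/-- The coefficient along `mom j` of the momentum vector evolved from `(a, b)`. -/
def momCoeff (a b : V) (t : ℝ) (j : ι) : ℝ :=
  Real.cos (2 * M.freq j * t) * ⟪M.pos j, b⟫_ℝ +
    (M.freq j)⁻¹ * Real.sin (2 * M.freq j * t) * ⟪M.mom j, a⟫_ℝ

/-- The position component of the classical flow on phase space. -/
def flowPos (a b : V) (t : ℝ) : V :=
  ∑ j, M.posCoeff a b t j • M.pos j

/-- The momentum component of the classical flow on phase space. -/
def flowMom (a b : V) (t : ℝ) : V :=
  ∑ j, M.momCoeff a b t j • M.mom j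

theorem flowPos_zero (a b : V) : M.flowPos a b 0 = a := by
  simp [flowPos, posCoeff, M.sum_inner_mom_smul_pos]

theorem flowMom_zero (a b : V) : M.flowMom a b 0 = b := by
  simp [flowMom, momCoeff, M.sum_inner_pos_smul_mom]

/-- The velocity of the position component at momentum `b`. -/
def posVelocity (b : V) : V :=
  ∑ j, (-2 * M.freq j ^ 2 * ⟪M.pos j, b⟫_ℝ) • M.pos j

/-- The velocity of the momentum component at position `a`. -/
def momVelocity (a : V) : V :=
  ∑ j, (2 * ⟪M.mom j, a⟫_ℝ) • M.mom j

theorem hasDerivAt_flowPos (a b : V) (t : ℝ) :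
    HasDerivAt (M.flowPos a b) (M.posVelocity (M.flowMom a b t)) t := by
  refine HasDerivAt.fun_sum fun j _ => HasDerivAt.smul_const ?_ (M.pos j)
  have hphase : HasDerivAt (fun t => 2 * M.freq j * t) (2 * M.freq j) t := by
    simpa using (hasDerivAt_id t).const_mul (2 * M.freq j)
  refine ((hphase.cos.mul_const _).sub ((hphase.sin.const_mul _).mul_const _)).congr_deriv ?_
  rw [flowMom, inner_pos_sum_smul_mom, momCoeff]
  have := (M.freq_pos j).ne'
  field_simp
  ring

theorem hasDerivAt_flowMom (a b : V) (t : ℝ) :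
    HasDerivAt (M.flowMom a b) (M.momVelocity (M.flowPos a b t)) t := by
  refine HasDerivAt.fun_sum fun j _ => HasDerivAt.smul_const ?_ (M.mom j)
  have hphase : HasDerivAt (fun t => 2 * M.freq j * t) (2 * M.freq j) t := by
    simpa using (hasDerivAt_id t).const_mul (2 * M.freq j)
  refine ((hphase.cos.mul_const _).add ((hphase.sin.const_mul _).mul_const _)).congr_deriv ?_
  rw [flowPos, inner_mom_sum_smul_pos, posCoeff]
  have := (M.freq_pos j).ne'
  field_simp
  ring

theorem continuous_posVelocity : Continuous M.posVelocity := by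
  unfold posVelocity
  fun_prop

theorem continuous_momVelocity : Continuous M.momVelocity := by
  unfold momVelocity
  fun_prop

theorem oscillator_weylSchwartz (a b : V) (φ : 𝓢(V, ℂ)) :
    M.oscillator (weylSchwartz a b φ) =
      weylSchwartz a b (M.oscillator φ + (posAlong (M.posVelocity b) φ +
        momAlong (M.momVelocity a) φ +
        (((⟪a, M.momVelocity a⟫_ℝ - ⟪M.posVelocity b, b⟫_ℝ) / 2 : ℝ) : ℂ) • φ)) := by
  have hscalar : (⟪a, M.momVelocity a⟫_ℝ - ⟪M.posVelocity b, b⟫_ℝ) / 2 =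
      ∑ j, (⟪M.mom j, a⟫_ℝ ^ 2 + M.freq j ^ 2 * ⟪M.pos j, b⟫_ℝ ^ 2) := by
    rw [momVelocity, posVelocity, inner_sum, sum_inner, ← Finset.sum_sub_distrib, Finset.sum_div]
    refine Finset.sum_congr rfl fun j _ => ?_
    rw [real_inner_smul_right, real_inner_smul_left, real_inner_comm (M.mom j) a]
    ring
  rw [hscalar, oscillator, posVelocity, momVelocity, posAlong_sum_smul, momAlong_sum_smul]
  simp only [LinearMap.sum_apply, Complex.ofReal_sum, Finset.sum_smul, ← Finset.sum_add_distrib,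
    map_sum]
  refine Finset.sum_congr rfl fun j _ => ?_
  simp only [LinearMap.add_apply, LinearMap.smul_apply, pow_two, Module.End.mul_apply,
    momAlong_weylSchwartz, posAlong_weylSchwartz, map_add, map_sub, map_smul]
  push_cast
  module

end Flow

section Dynamics

variable {ι V : Type*} [Fintype ι] [DecidableEq ι] [NormedAddCommGroup V] [InnerProductSpace ℝ V]
  [FiniteDimensional ℝ V] [MeasurableSpace V] [BorelSpace V] (M : NormalModes ι V)

theorem isSymmetricOp_oscillator : IsSymmetricOp M.oscillator :=
  IsSymmetricOp.sum fun _ _ =>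
    (isSymmetricOp_momAlong _).sq.add ((isSymmetricOp_posAlong _).sq.real_smul _)

theorem exists_generator_eq_schwartzGraph_oscillator :
    ∃ U, IsUnitaryGroup U ∧ (schwartzGraph M.oscillator).topologicalClosure = generator U :=
  exists_generator_eq_of_eigenvectors (w := M.energy)
    M.isSymmetricOp_oscillator.isSymmetricRel_schwartzGraph
    (fun l => by
      simpa only [oscillator_excited, map_smul] using
        toL2_mem_schwartzGraph M.oscillator (M.excited l))
    M.dense_span_excited

theorem hasCurveDerivAt_phase_smul_toL2_weylSchwartz_flow (a b : V) {w : ℝ} {φ : 𝓢(V, ℂ)}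
    (hφ : M.oscillator φ = (w : ℂ) • φ) (t : ℝ) :
    HasCurveDerivAt
      (fun t : ℝ => toL2 (Complex.exp (Complex.I * t * w) •
        weylSchwartz (M.flowPos a b t) (M.flowMom a b t) φ))
      (Complex.I • toL2 (M.oscillator (Complex.exp (Complex.I * t * w) •
        weylSchwartz (M.flowPos a b t) (M.flowMom a b t) φ))) t := by
  have hpos := M.hasDerivAt_flowPos a b
  have hmom := M.hasDerivAt_flowMom a b
  have hposc : Continuous (M.flowPos a b) :=
    continuous_iff_continuousAt.2 fun s => (hpos s).continuousAt
  have hmomc : Continuous (M.flowMom a b) :=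
    continuous_iff_continuousAt.2 fun s => (hmom s).continuousAt
  have hweyl := hasCurveDerivAt_toL2_weylSchwartz hpos hmom
    (M.continuous_posVelocity.comp hmomc) (M.continuous_momVelocity.comp hposc) φ t
  have hphase : HasCurveDerivAt (fun t : ℝ => Complex.exp (Complex.I * t * w))
      (Complex.exp (Complex.I * t * w) * (Complex.I * w)) t := by
    simpa using (((hasDerivAt_id t).ofReal_comp.const_mul Complex.I).mul_const (w : ℂ)).cexp
  simp only [map_smul toL2]
  refine (hphase.smul hweyl).congr_deriv ?_
  rw [map_smul M.oscillator, M.oscillator_weylSchwartz, hφ]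
  simp only [map_smul, map_add]
  module

theorem mul_weylL2_mul_eq_weylL2_flow
    {U : ℝ → Lp ℂ 2 (volume : Measure V) →L[ℂ] Lp ℂ 2 (volume : Measure V)}
    (hU : IsUnitaryGroup U) (hgen : schwartzGraph M.oscillator ≤ generator U) (a b : V) (t : ℝ) :
    U t * weylL2 a b * U (-t) = weylL2 (M.flowPos a b t) (M.flowMom a b t) := by
  have hevolve (a b : V) (l : List ι) (t : ℝ) :
      U (-t) (Complex.exp (Complex.I * t * M.energy l) •
        weylL2 (M.flowPos a b t) (M.flowMom a b t) (toL2 (M.excited l))) =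
          weylL2 a b (toL2 (M.excited l)) := by
    have h := hU.neg_apply_eq_of_hasDerivAt
      (M.hasCurveDerivAt_phase_smul_toL2_weylSchwartz_flow a b (M.oscillator_excited l))
      (fun s => hgen (toL2_mem_schwartzGraph _ _)) t
    simpa [flowPos_zero, flowMom_zero, weylL2_toL2] using h
  have hphase (l : List ι) : U t (toL2 (M.excited l)) =
      Complex.exp (Complex.I * t * M.energy l) • toL2 (M.excited l) := by
    have hrest (s : ℝ) : M.flowPos 0 0 s = 0 ∧ M.flowMom 0 0 s = 0 := by
      simp [flowPos, flowMom, posCoeff, momCoeff]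
    have h := hevolve 0 0 l t
    rw [(hrest t).1, (hrest t).2, weylL2_zero, one_apply_eq_self] at h
    exact (congrArg (U t) h).symm.trans (hU.apply_neg_apply t _)
  have hcomm : weylL2 (M.flowPos a b t) (M.flowMom a b t) * U t = U t * weylL2 a b := by
    refine ContinuousLinearMap.ext_on M.dense_span_excited ?_
    rintro _ ⟨l, rfl⟩
    change weylL2 _ _ (U t (toL2 (M.excited l))) = U t (weylL2 a b (toL2 (M.excited l)))
    rw [hphase, map_smul, ← hevolve a b l t, hU.apply_neg_apply]
  rw [← hcomm, mul_assoc, ← hU.map_add, add_neg_cancel, hU.map_zero, mul_one]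

end Dynamics

end NormalModes

/-! ### Normal modes of a quadratic Hamiltonian -/

section SpectralSums

variable {n : Type*} [Fintype n] [DecidableEq n] {A : Matrix n n ℝ} (hA : A.IsHermitian)

theorem sum_eigenvectorBasis_mul (x y : n) :
    ∑ j, hA.eigenvectorBasis j x * hA.eigenvectorBasis j y = if x = y then 1 else 0 := by
  have h := hA.eigenvectorBasis.sum_inner_mul_inner (EuclideanSpace.single x (1 : ℝ))
    (EuclideanSpace.single y (1 : ℝ))
  simpa [EuclideanSpace.inner_single_left, EuclideanSpace.inner_single_right, Pi.single_apply,
    eq_comm] using h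

theorem sum_eigenvalues_pow_mul (m : ℕ) (x y : n) :
    ∑ j, hA.eigenvalues j ^ m * hA.eigenvectorBasis j x * hA.eigenvectorBasis j y
      = (A ^ m) x y := by
  induction m generalizing x with
  | zero => simpa [Matrix.one_apply] using sum_eigenvectorBasis_mul hA x y
  | succ m ih =>
    rw [pow_succ', Matrix.mul_apply]
    simp only [← ih, Finset.mul_sum]
    rw [Finset.sum_comm]
    refine Finset.sum_congr rfl fun j _ => ?_
    have h := congrFun (hA.mulVec_eigenvectorBasis j) x
    simp only [Matrix.mulVec, dotProduct, Pi.smul_apply, smul_eq_mul] at h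
    rw [pow_succ, mul_assoc (hA.eigenvalues j ^ m), ← h, Finset.mul_sum, Finset.sum_mul]
    exact Finset.sum_congr rfl fun z _ => by ring

theorem sum_eigenvalues_mul (x y : n) :
    ∑ j, hA.eigenvalues j * hA.eigenvectorBasis j x * hA.eigenvectorBasis j y = A x y := by
  simpa using sum_eigenvalues_pow_mul hA 1 x y

end SpectralSums

theorem sum_smul_sum_smul_sq {ι n R : Type*} [Fintype n] [Ring R] [Algebra ℂ R] (s : Finset ι)
    (c : ι → ℂ) (α : ι → n → ℂ) (T : n → R) :
    ∑ j ∈ s, c j • (∑ x, α j x • T x) ^ 2 =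
      ∑ x, ∑ y, (∑ j ∈ s, c j * (α j x * α j y)) • (T x * T y) := by
  simp only [pow_two, Finset.sum_mul_sum, smul_mul_smul_comm, Finset.smul_sum, smul_smul,
    Finset.sum_smul]
  rw [Finset.sum_comm]
  exact Finset.sum_congr rfl fun x _ => Finset.sum_comm

section QuadraticHamiltonian

variable {n : Type*} [Fintype n] [DecidableEq n] {s : n → ℝ} {A : Matrix n n ℝ}

/-- Normal modes for the kinetic energy `∑ x, s x ^ 2 * p_x ^ 2` and the potential energy
`∑ x, ∑ y, A x y * q_x * q_y`: rescaling by `s` turns the problem into the diagonalization of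
`diagonal s * A * diagonal s`. -/
def normalModes (hs : ∀ x, 0 < s x) (hA : (Matrix.diagonal s * A * Matrix.diagonal s).PosDef) :
    NormalModes n (EuclideanSpace ℝ n) where
  pos j := WithLp.toLp 2 fun x => hA.1.eigenvectorBasis j x / s x
  mom j := WithLp.toLp 2 fun x => s x * hA.1.eigenvectorBasis j x
  freq j := √(hA.1.eigenvalues j)
  freq_pos j := Real.sqrt_pos.2 (hA.eigenvalues_pos j)
  inner_pos_mom j k := by
    rw [← orthonormal_iff_ite.1 hA.1.eigenvectorBasis.orthonormal j k]
    simp only [PiLp.inner_apply, RCLike.inner_apply, conj_trivial]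
    refine Finset.sum_congr rfl fun x _ => ?_
    have := (hs x).ne'
    field_simp
  sum_inner_mom_smul_pos a := by
    ext x
    have hexpand := congrArg (fun v : EuclideanSpace ℝ n => v x)
      (hA.1.eigenvectorBasis.sum_repr' (WithLp.toLp 2 fun x => s x * a x))
    simp only [WithLp.ofLp_sum, WithLp.ofLp_smul, Finset.sum_apply, Pi.smul_apply,
      PiLp.inner_apply, RCLike.inner_apply, conj_trivial, smul_eq_mul, mul_comm (s _),
      mul_assoc] at hexpand ⊢
    rw [← mul_div_cancel_right₀ (a x) (hs x).ne', ← hexpand, Finset.sum_div]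
    exact Finset.sum_congr rfl fun j _ => by rw [mul_div_assoc]

section

variable (hs : ∀ x, 0 < s x) (hA : (Matrix.diagonal s * A * Matrix.diagonal s).PosDef)

theorem sum_normalModes_mom_mul (x y : n) :
    ∑ j, (normalModes hs hA).mom j x * (normalModes hs hA).mom j y =
      if x = y then s x ^ 2 else 0 := by
  calc _ = s x * s y * ∑ j, hA.1.eigenvectorBasis j x * hA.1.eigenvectorBasis j y := by
        rw [Finset.mul_sum]
        exact Finset.sum_congr rfl fun j _ => mul_mul_mul_comm ..
    _ = _ := by
        rw [sum_eigenvectorBasis_mul]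
        split_ifs with h
        · rw [h, mul_one, pow_two]
        · rw [mul_zero]

theorem sum_freq_sq_mul_normalModes_pos_mul (x y : n) :
    ∑ j, (normalModes hs hA).freq j ^ 2 *
      ((normalModes hs hA).pos j x * (normalModes hs hA).pos j y) = A x y := by
  have hAxy := sum_eigenvalues_mul hA.1 x y
  rw [Matrix.mul_diagonal, Matrix.diagonal_mul] at hAxy
  calc _ = (s x * A x y * s y) / (s x * s y) := by
        rw [← hAxy, Finset.sum_div]
        refine Finset.sum_congr rfl fun j _ => ?_
        simp only [normalModes, Real.sq_sqrt (hA.eigenvalues_pos j).le]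
        ring
    _ = A x y := by
        have := (hs x).ne'
        have := (hs y).ne'
        field_simp

end

theorem posAlong_eq_sum_single (a : EuclideanSpace ℝ n) :
    posAlong a = ∑ x, (a x : ℂ) • posAlong (EuclideanSpace.single x (1 : ℝ)) := by
  rw [← posAlong_sum_smul]
  congr 1
  simpa using ((EuclideanSpace.basisFun n ℝ).sum_repr a).symm

theorem momAlong_eq_sum_single (b : EuclideanSpace ℝ n) :
    momAlong b = ∑ x, (b x : ℂ) • momAlong (EuclideanSpace.single x (1 : ℝ)) := by
  rw [← momAlong_sum_smul]
  congr 1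
  simpa using ((EuclideanSpace.basisFun n ℝ).sum_repr b).symm

theorem oscillator_normalModes (hs : ∀ x, 0 < s x)
    (hA : (Matrix.diagonal s * A * Matrix.diagonal s).PosDef) :
    (normalModes hs hA).oscillator =
      ∑ x, ((s x ^ 2 : ℝ) : ℂ) • momAlong (EuclideanSpace.single x (1 : ℝ)) ^ 2 +
      ∑ x, ∑ y, (A x y : ℂ) • (posAlong (EuclideanSpace.single x (1 : ℝ)) *
        posAlong (EuclideanSpace.single y (1 : ℝ))) := by
  have hkin := sum_smul_sum_smul_sq Finset.univ (fun _ => 1)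
    (fun j x => ((normalModes hs hA).mom j x : ℂ))
    fun x => momAlong (EuclideanSpace.single x (1 : ℝ))
  have hpot := sum_smul_sum_smul_sq Finset.univ
    (fun j => (((normalModes hs hA).freq j ^ 2 : ℝ) : ℂ))
    (fun j x => ((normalModes hs hA).pos j x : ℂ))
    fun x => posAlong (EuclideanSpace.single x (1 : ℝ))
  simp only [← momAlong_eq_sum_single, ← posAlong_eq_sum_single, one_smul, one_mul,
    ← Complex.ofReal_mul, ← Complex.ofReal_sum, sum_normalModes_mom_mul,
    sum_freq_sq_mul_normalModes_pos_mul] at hkin hpot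
  rw [NormalModes.oscillator, Finset.sum_add_distrib, hkin, hpot]
  simp only [pow_two, apply_ite Complex.ofReal, Complex.ofReal_zero, ite_smul, zero_smul,
    Finset.sum_ite_eq, Finset.mem_univ, if_true]

end QuadraticHamiltonian

/-! ### The oscillator system -/

/-- The real part of `f`, as a vector of `EuclideanSpace ℝ n`. -/
def reVec {n : Type*} (f : n → ℂ) : EuclideanSpace ℝ n := WithLp.toLp 2 fun x => (f x).re

/-- The imaginary part of `f`, as a vector of `EuclideanSpace ℝ n`. -/
def imVec {n : Type*} (f : n → ℂ) : EuclideanSpace ℝ n := WithLp.toLp 2 fun x => (f x).im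

section SchwartzPMap

variable {d L : ℕ}

theorem posOp_eq_posAlong (x : Box d L) : posOp x = posAlong (EuclideanSpace.single x (1 : ℝ)) := by
  ext φ q
  simp [posOp_apply, posAlong_apply, EuclideanSpace.inner_single_left]

theorem momOp_eq_momAlong (x : Box d L) : momOp x = momAlong (EuclideanSpace.single x (1 : ℝ)) :=
  rfl

theorem schwartzPMap_graph (T : Module.End ℂ 𝓢(Config d L, ℂ)) :
    (schwartzPMap T).graph = schwartzGraph T := by
  have happly (φ : 𝓢(Config d L, ℂ)) (hφ : toL2 φ ∈ (schwartzPMap T).domain) :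
      schwartzPMap T ⟨toL2 φ, hφ⟩ = toL2 (T φ) := by
    refine congrArg (fun φ => toL2 (T φ)) ((LinearEquiv.symm_apply_eq _).2 ?_)
    rfl
  ext x
  rw [LinearPMap.mem_graph_iff]
  constructor
  · rintro ⟨⟨_, φ, rfl⟩, hfst, hsnd⟩
    exact ⟨φ, Prod.ext hfst ((happly φ _).symm.trans hsnd)⟩
  · rintro ⟨φ, rfl⟩
    exact ⟨⟨toL2 φ, φ, rfl⟩, rfl, happly φ _⟩

theorem dense_domain_schwartzPMap (T : Module.End ℂ 𝓢(Config d L, ℂ)) :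
    Dense ((schwartzPMap T).domain : Set (HilbertL d L)) :=
  denseRange_toL2.mono (Set.range_subset_iff.2 fun φ => ⟨φ, rfl⟩)

theorem expI_closure_schwartzPMap {T : Module.End ℂ 𝓢(Config d L, ℂ)}
    {U : ℝ → HilbertL d L →L[ℂ] HilbertL d L} (hU : IsUnitaryGroup U)
    (hT : (schwartzGraph T).topologicalClosure = generator U) : expI (schwartzPMap T).closure = U :=
  hU.expI_closure_eq (by rw [schwartzPMap_graph, hT]) (dense_domain_schwartzPMap T)

theorem weyl_eq_weylL2 (f : Box d L → ℂ) : weyl f = weylL2 (reVec f) (imVec f) := by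
  have hop : ∑ x, (((f x).re : ℂ) • posOp x + ((f x).im : ℂ) • momOp x) =
      posAlong (reVec f) + momAlong (imVec f) := by
    rw [posAlong_eq_sum_single, momAlong_eq_sum_single, ← Finset.sum_add_distrib]
    simp only [posOp_eq_posAlong, momOp_eq_momAlong, reVec, imVec]
  rw [weyl, fieldOp, hop, expI_closure_schwartzPMap (isUnitaryGroup_weylL2_smul _ _)
    (topologicalClosure_schwartzGraph_posAlong_add_momAlong _ _)]
  simp only [one_smul]

end SchwartzPMap

section HamiltonianOp

theorem sum_sum_sym2_eq_two_nsmul {ι N : Type*} [Fintype ι] [AddCommMonoid N]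
    {F : Sym2 ι → N} (hF : ∀ x, F s(x, x) = 0) : ∑ x, ∑ y, F s(x, y) = 2 • ∑ e, F e := by
  classical
  rw [← Finset.sum_product', Finset.univ_product_univ,
    ← Finset.sum_fiberwise (Finset.univ : Finset (ι × ι)) (fun z => s(z.1, z.2)), Finset.smul_sum]
  refine Finset.sum_congr rfl fun e _ => ?_
  rw [Finset.sum_congr rfl (g := fun _ => F e) fun z hz => by rw [(Finset.mem_filter.1 hz).2],
    Finset.sum_const]
  induction e with | h x y =>
  rcases eq_or_ne x y with rfl | hxy
  · simp [hF]
  · have hfiber : (Finset.univ.filter fun z : ι × ι => s(z.1, z.2) = s(x, y)) =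
        {(x, y), (y, x)} := by
      ext ⟨u, v⟩
      simp
    rw [hfiber, Finset.card_pair (by simpa using fun h => absurd h hxy)]

theorem sum_sym2_smul_sub_sq {ι R : Type*} [Fintype ι] [Ring R] [Algebra ℂ R]
    {T : ι → R} (hT : ∀ x y, Commute (T x) (T y)) {w : ι → ι → ℂ} (hw : ∀ x y, w x y = w y x)
    {F : Sym2 ι → R} (hF : ∀ x y, F s(x, y) = w x y • (T x - T y) ^ 2) :
    ∑ e, F e = ∑ x, ∑ y, w x y • (T x * T x - T x * T y) := by
  have htwo : (2 : ℂ) • ∑ e, F e = (2 : ℂ) • ∑ x, ∑ y, w x y • (T x * T x - T x * T y) := by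
    rw [ofNat_smul_eq_nsmul, ← sum_sum_sym2_eq_two_nsmul fun x => by simp [hF], two_smul]
    nth_rewrite 3 [Finset.sum_comm]
    simp only [← Finset.sum_add_distrib]
    refine Finset.sum_congr rfl fun x _ => Finset.sum_congr rfl fun y _ => ?_
    rw [hF, hw y x, ← smul_add, (hT y x).eq]
    congr 1
    rw [pow_two, sub_mul, mul_sub, mul_sub, (hT y x).eq]
    abel
  exact smul_right_injective _ two_ne_zero htwo

variable {d L : ℕ}

/-- The coupling of two sites of a box, extended by zero to pairs that are not nearest
neighbours. -/
def coupling (p : Params d) (L : ℕ) (x y : Box d L) : ℝ :=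
  if siteDist (x : Site d) y = 1 then p.lam s(↑x, ↑y) else 0

theorem coupling_comm (p : Params d) (x y : Box d L) : coupling p L x y = coupling p L y x := by
  rw [coupling, coupling, siteDist_comm, Sym2.eq_swap]

theorem coupling_self (p : Params d) (x : Box d L) : coupling p L x x = 0 := by
  simp [coupling, siteDist]

theorem h0_apply (p : Params d) (x y : Box d L) :
    h0 p L x y = (if x = y then p.k x / 2 + ∑ u, coupling p L x u else 0) - coupling p L x y := by
  rw [h0, Matrix.of_apply]
  split_ifs with hxy hdist
  · subst hxy
    rw [coupling_self, sub_zero]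
    rfl
  · rw [coupling, if_pos hdist, zero_sub]
  · rw [coupling, if_neg hdist, sub_zero]

theorem hamiltonianOp_eq (p : Params d) :
    hamiltonianOp p L = ∑ x : Box d L, ((1 / (2 * p.m x) : ℝ) : ℂ) • momOp x ^ 2 +
      ∑ x, ∑ y, (h0 p L x y : ℂ) • (posOp x * posOp y) := by
  rw [hamiltonianOp, sum_sym2_smul_sub_sq (T := posOp) (w := fun x y => (coupling p L x y : ℂ))
    (fun x y => by simpa only [posOp_eq_posAlong] using commute_posAlong _ _)
    (fun x y => by rw [coupling_comm])
    (fun x y => by rw [Sym2.lift_mk, coupling, apply_ite Complex.ofReal, Complex.ofReal_zero,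
      ite_smul, zero_smul]),
    Finset.sum_add_distrib, add_assoc, ← Finset.sum_add_distrib]
  congr 1
  refine Finset.sum_congr rfl fun x _ => ?_
  simp only [h0_apply, Complex.ofReal_sub, apply_ite Complex.ofReal, Complex.ofReal_zero, sub_smul,
    ite_smul, zero_smul, Finset.sum_sub_distrib, Finset.sum_ite_eq, Finset.mem_univ, if_true,
    smul_sub, ← Finset.sum_smul, Complex.ofReal_add, Complex.ofReal_sum, add_smul, pow_two]
  abel

end HamiltonianOp

section SystemModes

variable {d : ℕ}

/-- The square roots of the diagonal entries of `μ`. -/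
def sqrtMass (p : Params d) (L : ℕ) (x : Box d L) : ℝ := √(1 / (2 * p.m x))

variable {L : ℕ} {p : Params d}

theorem sqrtMass_pos (hm : ∀ x, 0 < p.m x) (x : Box d L) : 0 < sqrtMass p L x :=
  Real.sqrt_pos.2 (one_div_pos.2 (mul_pos two_pos (hm x)))

theorem hL_eq : hL p L = Matrix.diagonal (sqrtMass p L) * h0 p L * Matrix.diagonal (sqrtMass p L) :=
  rfl

theorem hL_posDef (hm : ∀ x, 0 < p.m x) (h : (h0 p L).PosDef) : (hL p L).PosDef := by
  have hinj : Function.Injective (sqrtMu p L).mulVec := by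
    rw [Matrix.mulVec_injective_iff_isUnit, sqrtMu, Matrix.isUnit_diagonal, Pi.isUnit_iff]
    exact fun x => (sqrtMass_pos hm x).ne'.isUnit
  have hpos := h.conjTranspose_mul_mul_same hinj
  rwa [show (sqrtMu p L).conjTranspose = sqrtMu p L by simp [sqrtMu]] at hpos

/-- The normal modes of the oscillator system. -/
def systemModes (hm : ∀ x, 0 < p.m x) (h : (h0 p L).PosDef) : NormalModes (Box d L) (Config d L) :=
  normalModes (sqrtMass_pos hm) (hL_eq (p := p) ▸ hL_posDef hm h)

variable (hm : ∀ x, 0 < p.m x) (h : (h0 p L).PosDef)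

theorem oscillator_systemModes : (systemModes hm h).oscillator = hamiltonianOp p L := by
  rw [systemModes, oscillator_normalModes, hamiltonianOp_eq]
  simp only [posOp_eq_posAlong, momOp_eq_momAlong, sqrtMass,
    Real.sq_sqrt (one_div_nonneg.2 (mul_pos two_pos (hm _)).le)]

theorem heisenberg_weylL2 (a b : Config d L) (t : ℝ) :
    heisenberg p L t (weylL2 a b) =
      weylL2 ((systemModes hm h).flowPos a b t) ((systemModes hm h).flowMom a b t) := by
  obtain ⟨U, hU, hgen⟩ := (systemModes hm h).exists_generator_eq_schwartzGraph_oscillator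
  have hexp : expI (hamiltonian p L) = U :=
    expI_closure_schwartzPMap hU (by rw [← oscillator_systemModes hm h, hgen])
  rw [heisenberg, hexp]
  exact (systemModes hm h).mul_weylL2_mul_eq_weylL2_flow hU
    (hgen ▸ Submodule.le_topologicalClosure _) a b t

end SystemModes

/-! ### The kernels of the classical flow -/

section SpectralKernel

variable {n : Type*} [Fintype n] [DecidableEq n] {A : Matrix n n ℝ} (hA : A.IsHermitian)

/-- The matrix elements of `φ(A)` for a real function `φ`; this is the real counterpart of
`matFun`. -/
def spectralKernel (φ : ℝ → ℝ) (x y : n) : ℝ :=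
  ∑ j, φ (hA.eigenvalues j) * hA.eigenvectorBasis j x * hA.eigenvectorBasis j y

theorem matFun_ofReal (φ : ℝ → ℝ) (x y : n) :
    matFun hA (fun s => (φ s : ℂ)) x y = spectralKernel hA φ x y := by
  simp only [matFun, Matrix.of_apply, spectralKernel, Complex.ofReal_sum, Complex.ofReal_mul]

theorem sum_sum_mul_spectralKernel (φ : ℝ → ℝ) (u w : n → ℝ) :
    ∑ x, ∑ y, u x * w y * spectralKernel hA φ x y =
      ∑ j, φ (hA.eigenvalues j) * (∑ x, u x * hA.eigenvectorBasis j x) *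
        (∑ y, w y * hA.eigenvectorBasis j y) := by
  calc _ = ∑ x, ∑ j, ∑ y, φ (hA.eigenvalues j) * ((u x * hA.eigenvectorBasis j x) *
        (w y * hA.eigenvectorBasis j y)) := by
        refine Finset.sum_congr rfl fun x _ => ?_
        rw [Finset.sum_comm]
        refine Finset.sum_congr rfl fun y _ => ?_
        rw [spectralKernel, Finset.mul_sum]
        exact Finset.sum_congr rfl fun j _ => by ring
    _ = _ := by
        rw [Finset.sum_comm]
        refine Finset.sum_congr rfl fun j _ => ?_
        rw [mul_assoc, Finset.sum_mul_sum]
        simp only [Finset.mul_sum]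

theorem continuous_spectralKernel {φ : ℝ → ℝ → ℝ} (hφ : ∀ s, Continuous fun t => φ t s)
    (x y : n) : Continuous fun t => spectralKernel hA (φ t) x y :=
  continuous_finsetSum _ fun j _ =>
    ((hφ (hA.eigenvalues j)).mul continuous_const).mul continuous_const

theorem hasSum_spectralKernel {φ : ℝ → ℝ} {c : ℕ → ℝ} {e : ℕ → ℕ}
    (hφ : ∀ j, HasSum (fun m => c m * hA.eigenvalues j ^ e m) (φ (hA.eigenvalues j))) (x y : n) :
    HasSum (fun m => c m * (A ^ e m) x y) (spectralKernel hA φ x y) := by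
  refine HasSum.congr_fun (hasSum_sum (s := Finset.univ) fun j _ =>
    ((hφ j).mul_right (hA.eigenvectorBasis j x)).mul_right (hA.eigenvectorBasis j y)) fun m => ?_
  rw [← sum_eigenvalues_pow_mul hA, Finset.mul_sum]
  exact Finset.sum_congr rfl fun j _ => by ring

theorem eigenvalues_le_of_sum_abs_le {B : ℝ} (h : ∀ x, ∑ y, |A x y| ≤ B) (j : n) :
    hA.eigenvalues j ≤ B := by
  have hev : Module.End.HasEigenvalue (Matrix.toLin' A) (hA.eigenvalues j) := by
    rw [Module.End.hasEigenvalue_iff_mem_spectrum, Matrix.spectrum_toLin']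
    exact hA.eigenvalues_mem_spectrum_real j
  obtain ⟨x, hx⟩ := eigenvalue_mem_ball hev
  simp only [mem_closedBall_iff_norm, Real.norm_eq_abs] at hx
  calc hA.eigenvalues j ≤ |A x x| + |hA.eigenvalues j - A x x| := by
        linarith [le_abs_self (A x x), le_abs_self (hA.eigenvalues j - A x x)]
    _ ≤ |A x x| + ∑ y ∈ Finset.univ.erase x, |A x y| := by gcongr
    _ = ∑ y, |A x y| := Finset.add_sum_erase _ (fun y => |A x y|) (Finset.mem_univ x)
    _ ≤ B := h x

end SpectralKernel

section FlowFun

/-- The functions of the one-particle operator that generate the classical flow: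
`cos (2 t √s)`, `sin (2 t √s) / √s` and `√s sin (2 t √s)`. -/
def flowFun (i : Fin 3) (t s : ℝ) : ℝ :=
  ![Real.cos (2 * √s * t), (√s)⁻¹ * Real.sin (2 * √s * t), √s * Real.sin (2 * √s * t)] i

theorem continuous_flowFun (i : Fin 3) (s : ℝ) : Continuous fun t => flowFun i t s := by
  fin_cases i <;>
    simp only [flowFun, Fin.zero_eta, Fin.mk_one, Fin.reduceFinMk, Matrix.cons_val] <;> fun_prop

theorem abs_sqrt_mul_flowFun_le (i : Fin 3) (t : ℝ) {s B : ℝ} (hs : 0 < s) (hB : s ≤ B) :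
    |√s * flowFun i t s| ≤ 1 + B := by
  have hpos : 0 < √s := Real.sqrt_pos.2 hs
  have hsq : √s * √s = s := Real.mul_self_sqrt hs.le
  have hsqrt : √s ≤ 1 + B := by nlinarith [sq_nonneg (√s - 1)]
  have hcos := Real.abs_cos_le_one (2 * √s * t)
  have hsin := Real.abs_sin_le_one (2 * √s * t)
  fin_cases i <;> simp only [flowFun, Fin.zero_eta, Fin.mk_one, Fin.reduceFinMk, Matrix.cons_val]
  · rw [abs_mul, abs_of_pos hpos]
    exact (mul_le_of_le_one_right hpos.le hcos).trans hsqrt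
  · rw [mul_inv_cancel_left₀ hpos.ne']
    linarith
  · rw [← mul_assoc, hsq, abs_mul, abs_of_pos hs]
    exact (mul_le_of_le_one_right hs.le hsin).trans (hB.trans (le_add_of_nonneg_left zero_le_one))

theorem exists_hasSum_flowFun (i : Fin 3) (t : ℝ) : ∃ (c : ℕ → ℝ) (e : ℕ → ℕ), ∀ s, 0 < s →
    HasSum (fun n => c n * s ^ e n) (flowFun i t s) := by
  have hpow (s : ℝ) (hs : 0 < s) (n : ℕ) : (2 * √s * t) ^ (2 * n) = (2 * t) ^ (2 * n) * s ^ n := by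
    rw [mul_right_comm, mul_pow, pow_mul (√s), Real.sq_sqrt hs.le]
  fin_cases i
  · refine ⟨fun n => (-1) ^ n * (2 * t) ^ (2 * n) / (2 * n).factorial, id, fun s hs =>
      (Real.hasSum_cos (2 * √s * t)).congr_fun fun n => ?_⟩
    rw [hpow s hs, id]
    ring
  · refine ⟨fun n => (-1) ^ n * (2 * t) ^ (2 * n + 1) / (2 * n + 1).factorial, id, fun s hs =>
      ((Real.hasSum_sin (2 * √s * t)).mul_left (√s)⁻¹).congr_fun fun n => ?_⟩
    have := (Real.sqrt_pos.2 hs).ne'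
    rw [pow_succ (2 * √s * t), hpow s hs, id]
    field_simp
    ring
  · refine ⟨fun n => (-1) ^ n * (2 * t) ^ (2 * n + 1) / (2 * n + 1).factorial, (· + 1), fun s hs =>
      ((Real.hasSum_sin (2 * √s * t)).mul_left (√s)).congr_fun fun n => ?_⟩
    rw [pow_succ (2 * √s * t), hpow s hs, pow_succ s]
    nth_rewrite 2 [← Real.mul_self_sqrt hs.le]
    ring

end FlowFun

section FlowSup

variable {n : Type*} [Fintype n] [DecidableEq n] {A : Matrix n n ℝ} (hA : A.IsHermitian)

theorem enorm_rpow_le_iSup_rat {φ : ℝ → ℝ} (hφ : Continuous φ) (r t : ℝ) :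
    ‖φ t‖ₑ ^ r ≤ ⨆ q : ℚ, ‖φ q‖ₑ ^ r := by
  have hclosed : IsClosed {t | ‖φ t‖ₑ ^ r ≤ ⨆ q : ℚ, ‖φ q‖ₑ ^ r} :=
    isClosed_le (ENNReal.continuous_rpow_const.comp hφ.enorm) continuous_const
  exact hclosed.closure_subset_iff.2
    (Set.range_subset_iff.2 fun q => le_iSup (fun q : ℚ => ‖φ q‖ₑ ^ r) q)
    (Rat.denseRange_cast (𝕜 := ℝ) t)

/-- The supremum over time of the `r`-th powers of the kernels of the classical flow. The times
range over `ℚ` so that this stays measurable when `A` is random. -/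
def flowSup (r : ℝ) (x y : n) : ℝ≥0∞ :=
  ∑ i, ⨆ q : ℚ, ‖spectralKernel hA (flowFun i q) x y‖ₑ ^ r

theorem sum_enorm_spectralKernel_rpow_le_flowSup (r t : ℝ) (x y : n) :
    ∑ i, ‖spectralKernel hA (flowFun i t) x y‖ₑ ^ r ≤ flowSup hA r x y :=
  Finset.sum_le_sum fun i _ =>
    enorm_rpow_le_iSup_rat (continuous_spectralKernel hA (continuous_flowFun i) x y) r t

end FlowSup

/-! ### Bounds that are uniform in the volume -/

section Uniform

variable {d L : ℕ} {p : Params d} {mMin mMax kMax lamMax : ℝ}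

theorem Params.Bounds.m_pos (hp : p.Bounds mMin mMax kMax lamMax) (x : Site d) : 0 < p.m x :=
  hp.mMin_pos.trans_le (hp.m_mem x).1

theorem Params.Bounds.coupling_nonneg (hp : p.Bounds mMin mMax kMax lamMax) (x y : Box d L) :
    0 ≤ coupling p L x y := by
  rw [coupling]
  split_ifs with hdist
  exacts [(hp.lam_mem _ _ hdist).1, le_rfl]

theorem card_neighbors_le (x : Box d L) :
    (Finset.univ.filter fun u : Box d L => siteDist (x : Site d) u = 1).card ≤ 3 ^ d := by
  have hcube : (Finset.univ.filter fun u : Box d L => siteDist (x : Site d) u = 1).card ≤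
      (Finset.Icc (fun i => (x : Site d) i - 1) (fun i => (x : Site d) i + 1)).card := by
    refine Finset.card_le_card_of_injOn (fun u => (u : Site d)) (fun u hu => ?_)
      Subtype.val_injective.injOn
    have hcoord (i : Fin d) : ((x : Site d) i - (u : Site d) i).natAbs ≤ 1 := by
      rw [← (Finset.mem_filter.1 hu).2, siteDist]
      exact Finset.single_le_sum (f := fun i => ((x : Site d) i - (u : Site d) i).natAbs)
        (fun _ _ => Nat.zero_le _) (Finset.mem_univ i)
    simp only [Finset.coe_Icc, Set.mem_Icc, Pi.le_def]
    exact ⟨fun i => by have := hcoord i; omega, fun i => by have := hcoord i; omega⟩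
  have hside (i : Fin d) : (Finset.Icc ((x : Site d) i - 1) ((x : Site d) i + 1)).card = 3 := by
    rw [Int.card_Icc]
    omega
  simpa only [Pi.card_Icc, hside, Finset.prod_const, Finset.card_univ, Fintype.card_fin] using hcube

theorem Params.Bounds.sum_coupling_le (hp : p.Bounds mMin mMax kMax lamMax) (x : Box d L) :
    ∑ u, coupling p L x u ≤ 3 ^ d * |lamMax| := by
  simp only [coupling, ← Finset.sum_filter]
  calc _ ≤ ∑ _u ∈ Finset.univ.filter (fun u : Box d L => siteDist (x : Site d) u = 1), |lamMax| :=
        Finset.sum_le_sum fun u hu =>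
          ((hp.lam_mem _ _ (Finset.mem_filter.1 hu).2).2).trans (le_abs_self _)
    _ ≤ 3 ^ d * |lamMax| := by
      rw [Finset.sum_const, nsmul_eq_mul]
      exact mul_le_mul_of_nonneg_right (by exact_mod_cast card_neighbors_le x) (abs_nonneg _)

theorem Params.Bounds.sum_abs_h0_le (hp : p.Bounds mMin mMax kMax lamMax) (x : Box d L) :
    ∑ y, |h0 p L x y| ≤ |kMax| / 2 + 2 * (3 ^ d * |lamMax|) := by
  have hdiag : 0 ≤ p.k x / 2 + ∑ u, coupling p L x u :=
    add_nonneg (div_nonneg (hp.k_mem x).1 two_pos.le)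
      (Finset.sum_nonneg fun u _ => hp.coupling_nonneg x u)
  calc ∑ y, |h0 p L x y|
      ≤ ∑ y, ((if x = y then p.k x / 2 + ∑ u, coupling p L x u else 0) + coupling p L x y) := by
        refine Finset.sum_le_sum fun y _ => ?_
        rw [h0_apply]
        refine (abs_sub _ _).trans_eq ?_
        rw [abs_of_nonneg (hp.coupling_nonneg x y),
          abs_of_nonneg (by split_ifs; exacts [hdiag, le_rfl])]
    _ = p.k x / 2 + 2 * ∑ u, coupling p L x u := by
        rw [Finset.sum_add_distrib, Finset.sum_ite_eq, if_pos (Finset.mem_univ x)]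
        ring
    _ ≤ |kMax| / 2 + 2 * (3 ^ d * |lamMax|) := by
        gcongr
        exacts [(hp.k_mem x).2.trans (le_abs_self _), hp.sum_coupling_le x]

/-- A common bound for the entries `(2 m_x)^{-1/2}` of `μ^{1/2}` and for their inverses. -/
def massBound (mMin mMax : ℝ) : ℝ := max √(1 / (2 * mMin)) √(2 * mMax)

theorem massBound_nonneg (mMin mMax : ℝ) : 0 ≤ massBound mMin mMax :=
  le_max_of_le_left (Real.sqrt_nonneg _)

theorem Params.Bounds.sqrtMass_le (hp : p.Bounds mMin mMax kMax lamMax) (x : Box d L) :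
    sqrtMass p L x ≤ massBound mMin mMax := by
  have := hp.mMin_pos
  have := (hp.m_mem x).1
  exact le_max_of_le_left (Real.sqrt_le_sqrt (by gcongr))

theorem Params.Bounds.inv_sqrtMass_le (hp : p.Bounds mMin mMax kMax lamMax) (x : Box d L) :
    (sqrtMass p L x)⁻¹ ≤ massBound mMin mMax := by
  rw [sqrtMass, ← Real.sqrt_inv, one_div, inv_inv]
  exact le_max_of_le_right (Real.sqrt_le_sqrt (mul_le_mul_of_nonneg_left (hp.m_mem x).2 two_pos.le))

/-- A bound for the eigenvalues of all the operators `h_L`. -/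
def eigenBound (d : ℕ) (mMin mMax kMax lamMax : ℝ) : ℝ :=
  massBound mMin mMax ^ 2 * (|kMax| / 2 + 2 * (3 ^ d * |lamMax|))

theorem eigenBound_nonneg : 0 ≤ eigenBound d mMin mMax kMax lamMax := by
  rw [eigenBound]
  positivity

theorem Params.Bounds.eigenvalues_hL_le (hp : p.Bounds mMin mMax kMax lamMax) (j : Box d L) :
    (hL_isHermitian p L).eigenvalues j ≤ eigenBound d mMin mMax kMax lamMax := by
  refine eigenvalues_le_of_sum_abs_le _ (fun x => ?_) j
  have hs := sqrtMass_pos (L := L) hp.m_pos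
  calc ∑ y, |hL p L x y| ≤ ∑ y, massBound mMin mMax ^ 2 * |h0 p L x y| := by
        refine Finset.sum_le_sum fun y _ => ?_
        rw [hL_eq, Matrix.mul_diagonal, Matrix.diagonal_mul, abs_mul, abs_mul, abs_of_pos (hs x),
          abs_of_pos (hs y), mul_right_comm, pow_two]
        gcongr
        exacts [(hs y).le, massBound_nonneg _ _, hp.sqrtMass_le x, hp.sqrtMass_le y]
    _ ≤ _ := by
        rw [← Finset.mul_sum, eigenBound]
        exact mul_le_mul_of_nonneg_left (hp.sum_abs_h0_le x) (sq_nonneg _)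

theorem enorm_matFun_rpow_le_eigenCorrelator {α r M : ℝ} (hr : 0 ≤ r) (hM : 0 < M) {φ : ℝ → ℂ}
    (hpos : ∀ j, 0 < (hL_isHermitian p L).eigenvalues j)
    (hφ : ∀ j, ‖φ ((hL_isHermitian p L).eigenvalues j)‖ ≤
      (hL_isHermitian p L).eigenvalues j ^ α * M) (x y : Box d L) :
    ‖matFun (hL_isHermitian p L) φ x y‖ₑ ^ r ≤
      ENNReal.ofReal (M ^ r) * eigenCorrelator α r p L x y := by
  classical
  let u : ℝ → ℂ := fun s => if s ∈ Set.range (hL_isHermitian p L).eigenvalues then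
    φ s / ((s ^ α * M : ℝ) : ℂ) else 0
  have hu_le (s : ℝ) : ‖u s‖ ≤ 1 := by
    simp only [u]
    split_ifs with hs
    · obtain ⟨j, rfl⟩ := hs
      have hden := mul_pos (Real.rpow_pos_of_pos (hpos j) α) hM
      rw [norm_div, Complex.norm_of_nonneg hden.le, div_le_one hden]
      exact hφ j
    · simp
  have hmat : matFun (hL_isHermitian p L) φ x y =
      M * matFun (hL_isHermitian p L) (fun s => ((s ^ α : ℝ) : ℂ) * u s) x y := by
    simp only [matFun, Matrix.of_apply, Finset.mul_sum]
    refine Finset.sum_congr rfl fun j _ => ?_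
    have hMne : (M : ℂ) ≠ 0 := Complex.ofReal_ne_zero.2 hM.ne'
    have hpow := Complex.ofReal_ne_zero.2 (Real.rpow_pos_of_pos (hpos j) α).ne'
    simp only [u]
    rw [if_pos (Set.mem_range_self j), Complex.ofReal_mul]
    field_simp
  have hM_enorm : ‖(M : ℂ)‖ₑ ^ r = ENNReal.ofReal (M ^ r) := by
    rw [← ofReal_norm, Complex.norm_of_nonneg hM.le, ENNReal.ofReal_rpow_of_pos hM]
  rw [hmat, enorm_mul, ENNReal.mul_rpow_of_nonneg _ _ hr, hM_enorm]
  gcongr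
  exact le_iSup₂ (f := fun (u : ℝ → ℂ) (_ : ∀ s, ‖u s‖ ≤ 1) =>
    ‖matFun (hL_isHermitian p L) (fun s => ((s ^ α : ℝ) : ℂ) * u s) x y‖ₑ ^ r) u hu_le

theorem Params.Bounds.enorm_flowKernel_rpow_le (hp : p.Bounds mMin mMax kMax lamMax)
    (h : (h0 p L).PosDef) {r : ℝ} (hr : 0 ≤ r) (i : Fin 3) (t : ℝ) (x y : Box d L) :
    ‖spectralKernel (hL_isHermitian p L) (flowFun i t) x y‖ₑ ^ r ≤
      ENNReal.ofReal ((1 + eigenBound d mMin mMax kMax lamMax) ^ r) *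
        eigenCorrelator (-1 / 2) r p L x y := by
  have hpos : ∀ j, 0 < (hL_isHermitian p L).eigenvalues j := (hL_posDef hp.m_pos h).eigenvalues_pos
  have hle (j : Box d L) : ‖(flowFun i t ((hL_isHermitian p L).eigenvalues j) : ℂ)‖ ≤
      (hL_isHermitian p L).eigenvalues j ^ (-1 / 2 : ℝ) *
        (1 + eigenBound d mMin mMax kMax lamMax) := by
    have hflow := abs_sqrt_mul_flowFun_le i t (hpos j) (hp.eigenvalues_hL_le j)
    rw [abs_mul, abs_of_nonneg (Real.sqrt_nonneg _)] at hflow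
    rw [neg_div, Real.rpow_neg (hpos j).le, ← Real.sqrt_eq_rpow, Complex.norm_real,
      Real.norm_eq_abs, ← div_eq_inv_mul, le_div_iff₀' (Real.sqrt_pos.2 (hpos j))]
    exact hflow
  have hmat := enorm_matFun_rpow_le_eigenCorrelator (φ := fun s => flowFun i t s) hr
    (add_pos_of_pos_of_nonneg one_pos eigenBound_nonneg) hpos hle x y
  rwa [matFun_ofReal, ← ofReal_norm, Complex.norm_real, ofReal_norm] at hmat

theorem Params.Bounds.flowSup_le (hp : p.Bounds mMin mMax kMax lamMax) (h : (h0 p L).PosDef)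
    {r : ℝ} (hr : 0 ≤ r) (x y : Box d L) :
    flowSup (hL_isHermitian p L) r x y ≤
      3 * ENNReal.ofReal ((1 + eigenBound d mMin mMax kMax lamMax) ^ r) *
        eigenCorrelator (-1 / 2) r p L x y := by
  rw [flowSup]
  refine (Finset.sum_le_card_nsmul _ _ _ fun i _ => iSup_le fun q : ℚ =>
    hp.enorm_flowKernel_rpow_le h hr i q x y).trans_eq ?_
  rw [Finset.card_univ, Fintype.card_fin, nsmul_eq_mul, Nat.cast_ofNat, mul_assoc]

end Uniform

section Measurability

variable {d L : ℕ} {Ω : Type*} [MeasurableSpace Ω] {P : Measure Ω} {p : Ω → Params d}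

theorem measurable_hL (hm : ∀ x, Measurable fun ω => (p ω).m x)
    (hk : ∀ x, Measurable fun ω => (p ω).k x)
    (hlam : ∀ x y, siteDist x y = 1 → Measurable fun ω => (p ω).lam s(x, y))
    (x y : Box d L) : Measurable fun ω => hL (p ω) L x y := by
  have hcoupling (x u : Box d L) : Measurable fun ω => coupling (p ω) L x u := by
    simp only [coupling]
    split_ifs with hdist
    exacts [hlam _ _ hdist, measurable_const]
  have hsqrtMass (x : Box d L) : Measurable fun ω => sqrtMass (p ω) L x :=
    (((hm x).const_mul 2).const_div 1).sqrt
  simp only [hL_eq, Matrix.mul_diagonal, Matrix.diagonal_mul, h0_apply]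
  refine ((hsqrtMass x).mul (Measurable.sub ?_ (hcoupling x y))).mul (hsqrtMass y)
  split_ifs
  · exact ((hk x).div_const 2).add (Finset.measurable_fun_sum _ fun u _ => hcoupling x u)
  · exact measurable_const

theorem measurable_matrix_pow {n : Type*} [Fintype n] [DecidableEq n] {A : Ω → Matrix n n ℝ}
    (hA : ∀ x y, Measurable fun ω => A ω x y) (k : ℕ) (x y : n) :
    Measurable fun ω => (A ω ^ k) x y := by
  induction k generalizing x with
  | zero => simp
  | succ k ih =>
    simp only [pow_succ', Matrix.mul_apply]
    exact Finset.measurable_fun_sum _ fun z _ => (hA x z).mul (ih z)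

/-- The eigenvectors of `A ω` need not be measurable in `ω`, so the kernel is expanded in powers of
`A ω`. -/
theorem aemeasurable_spectralKernel_flowFun {n : Type*} [Fintype n] [DecidableEq n]
    {A : Ω → Matrix n n ℝ} (hA : ∀ ω, (A ω).IsHermitian)
    (hmeas : ∀ x y, Measurable fun ω => A ω x y) (hpos : ∀ᵐ ω ∂P, (A ω).PosDef)
    (i : Fin 3) (t : ℝ) (x y : n) :
    AEMeasurable (fun ω => spectralKernel (hA ω) (flowFun i t) x y) P := by
  obtain ⟨c, e, hce⟩ := exists_hasSum_flowFun i t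
  refine aemeasurable_of_tendsto_metrizable_ae'
    (f := fun N ω => ∑ k ∈ Finset.range N, c k * (A ω ^ e k) x y) (fun N => ?_) ?_
  · exact (Finset.measurable_fun_sum _ fun k _ =>
      (measurable_matrix_pow hmeas (e k) x y).const_mul (c k)).aemeasurable
  · filter_upwards [hpos] with ω hω
    exact (hasSum_spectralKernel (hA ω) (fun j => hce _ (hω.eigenvalues_pos j)) x y).tendsto_sum_nat

theorem aemeasurable_flowSup {n : Type*} [Fintype n] [DecidableEq n]
    {A : Ω → Matrix n n ℝ} (hA : ∀ ω, (A ω).IsHermitian)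
    (hmeas : ∀ x y, Measurable fun ω => A ω x y) (hpos : ∀ᵐ ω ∂P, (A ω).PosDef) (r : ℝ) (x y : n) :
    AEMeasurable (fun ω => flowSup (hA ω) r x y) P :=
  Finset.aemeasurable_fun_sum _ fun i _ => AEMeasurable.iSup fun q =>
    (aemeasurable_spectralKernel_flowFun hA hmeas hpos i q x y).enorm.pow_const r

end Measurability

/-! ### The symplectic form along the classical flow -/

theorem NormalModes.inner_flowMom_sub_inner_flowPos {ι V : Type*} [Fintype ι] [DecidableEq ι]
    [NormedAddCommGroup V] [InnerProductSpace ℝ V] (M : NormalModes ι V) (a b c e : V) (t : ℝ) :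
    ⟪c, M.flowMom a b t⟫_ℝ - ⟪M.flowPos a b t, e⟫_ℝ =
      ∑ j, (Real.cos (2 * M.freq j * t) *
          (⟪M.pos j, b⟫_ℝ * ⟪M.mom j, c⟫_ℝ - ⟪M.mom j, a⟫_ℝ * ⟪M.pos j, e⟫_ℝ) +
        (M.freq j)⁻¹ * Real.sin (2 * M.freq j * t) * (⟪M.mom j, a⟫_ℝ * ⟪M.mom j, c⟫_ℝ) +
        M.freq j * Real.sin (2 * M.freq j * t) * (⟪M.pos j, b⟫_ℝ * ⟪M.pos j, e⟫_ℝ)) := by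
  rw [flowMom, flowPos, inner_sum, sum_inner, ← Finset.sum_sub_distrib]
  refine Finset.sum_congr rfl fun j _ => ?_
  rw [real_inner_smul_right, real_inner_smul_left, real_inner_comm (M.mom j) c, posCoeff, momCoeff]
  ring

section Rescale

variable {n : Type*}

/-- The test function `f` in the coordinates in which the kinetic energy is the identity: real
parts are multiplied and imaginary parts divided by `s`. -/
def rescale (s : n → ℝ) (f : n → ℂ) (x : n) : ℂ := ⟨s x * (f x).re, (f x).im / s x⟩

theorem enorm_rescale_le {s : n → ℝ} {x : n} {D : ℝ} (hs : 0 < s x) (hsD : s x ≤ D)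
    (hsD' : (s x)⁻¹ ≤ D) (f : n → ℂ) : ‖rescale s f x‖ₑ ≤ ENNReal.ofReal (D * ‖f x‖) := by
  rw [← ofReal_norm]
  have hD : 0 ≤ D := hs.le.trans hsD
  refine ENNReal.ofReal_le_ofReal ((sq_le_sq₀ (norm_nonneg _) (by positivity)).1 ?_)
  rw [mul_pow, Complex.sq_norm, Complex.sq_norm, Complex.normSq_apply, Complex.normSq_apply,
    rescale, div_eq_inv_mul]
  have hre := mul_le_mul_of_nonneg_right (pow_le_pow_left₀ hs.le hsD 2) (sq_nonneg (f x).re)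
  have him := mul_le_mul_of_nonneg_right (pow_le_pow_left₀ (inv_pos.2 hs).le hsD' 2)
    (sq_nonneg (f x).im)
  linarith

variable [Fintype n] [DecidableEq n] {s : n → ℝ} {A : Matrix n n ℝ} (hs : ∀ x, 0 < s x)
  (hA : (Matrix.diagonal s * A * Matrix.diagonal s).PosDef)

theorem normalModes_freq (j : n) : (normalModes hs hA).freq j = √(hA.1.eigenvalues j) := rfl

theorem inner_normalModes_mom_reVec (f : n → ℂ) (j : n) :
    ⟪(normalModes hs hA).mom j, reVec f⟫_ℝ =
      ∑ x, (rescale s f x).re * hA.1.eigenvectorBasis j x := by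
  simp only [PiLp.inner_apply, normalModes, reVec, rescale, RCLike.inner_apply, conj_trivial]
  exact Finset.sum_congr rfl fun x _ => by ring

theorem inner_normalModes_pos_imVec (f : n → ℂ) (j : n) :
    ⟪(normalModes hs hA).pos j, imVec f⟫_ℝ =
      ∑ x, (rescale s f x).im * hA.1.eigenvectorBasis j x := by
  simp only [PiLp.inner_apply, normalModes, imVec, rescale, RCLike.inner_apply, conj_trivial]
  exact Finset.sum_congr rfl fun x _ => by ring

theorem inner_flowMom_sub_inner_flowPos_normalModes (f g : n → ℂ) (t : ℝ) :
    ⟪reVec g, (normalModes hs hA).flowMom (reVec f) (imVec f) t⟫_ℝ -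
        ⟪(normalModes hs hA).flowPos (reVec f) (imVec f) t, imVec g⟫_ℝ =
      ∑ x, ∑ y, (((rescale s f x).im * (rescale s g y).re - (rescale s f x).re * (rescale s g y).im)
          * spectralKernel hA.1 (flowFun 0 t) x y +
        (rescale s f x).re * (rescale s g y).re * spectralKernel hA.1 (flowFun 1 t) x y +
        (rescale s f x).im * (rescale s g y).im * spectralKernel hA.1 (flowFun 2 t) x y) := by
  rw [NormalModes.inner_flowMom_sub_inner_flowPos]
  simp only [sub_mul, Finset.sum_add_distrib, Finset.sum_sub_distrib, sum_sum_mul_spectralKernel,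
    ← inner_normalModes_mom_reVec hs hA, ← inner_normalModes_pos_imVec hs hA]
  simp only [← Finset.sum_add_distrib, ← Finset.sum_sub_distrib]
  refine Finset.sum_congr rfl fun j _ => ?_
  simp only [flowFun, normalModes_freq, Matrix.cons_val]
  ring

theorem enorm_im_mul_re_sub_add_le (z w : ℂ) (k : Fin 3 → ℝ) :
    ‖(z.im * w.re - z.re * w.im) * k 0 + z.re * w.re * k 1 + z.im * w.im * k 2‖ₑ ≤
      ∑ i, ‖z‖ₑ * ‖w‖ₑ * ‖k i‖ₑ := by
  have hre (z : ℂ) : ‖z.re‖ₑ ≤ ‖z‖ₑ := enorm_le_iff_norm_le.2 (Complex.abs_re_le_norm z)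
  have him (z : ℂ) : ‖z.im‖ₑ ≤ ‖z‖ₑ := enorm_le_iff_norm_le.2 (Complex.abs_im_le_norm z)
  have hcross : ‖z.im * w.re - z.re * w.im‖ₑ ≤ ‖z‖ₑ * ‖w‖ₑ := by
    have h := him (z * starRingEnd ℂ w)
    rw [enorm_mul, RCLike.enorm_conj, Complex.mul_im, Complex.conj_re, Complex.conj_im] at h
    rwa [show z.im * w.re - z.re * w.im = z.re * -w.im + z.im * w.re by ring]
  rw [Fin.sum_univ_three]
  refine (enorm_add_le _ _).trans (add_le_add ((enorm_add_le _ _).trans (add_le_add ?_ ?_)) ?_) <;>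
    rw [enorm_mul] <;> gcongr
  · exact (enorm_mul _ _).trans_le (mul_le_mul' (hre z) (hre w))
  · exact (enorm_mul _ _).trans_le (mul_le_mul' (him z) (him w))

theorem enorm_symplectic_normalModes_le (f g : n → ℂ) (t : ℝ) :
    ‖⟪reVec g, (normalModes hs hA).flowMom (reVec f) (imVec f) t⟫_ℝ -
        ⟪(normalModes hs hA).flowPos (reVec f) (imVec f) t, imVec g⟫_ℝ‖ₑ ≤
      ∑ x, ∑ y, ∑ i, ‖rescale s f x‖ₑ * ‖rescale s g y‖ₑ *
        ‖spectralKernel hA.1 (flowFun i t) x y‖ₑ := by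
  rw [inner_flowMom_sub_inner_flowPos_normalModes]
  exact (enorm_sum_le _ _).trans <| Finset.sum_le_sum fun x _ =>
    (enorm_sum_le _ _).trans <| Finset.sum_le_sum fun y _ =>
      enorm_im_mul_re_sub_add_le _ _ fun i => spectralKernel hA.1 (flowFun i t) x y

end Rescale

/-! ### Averaged commutator bounds -/

theorem rpow_sum_le_sum_rpow {ι : Type*} (s : Finset ι) (f : ι → ℝ≥0∞) {r : ℝ} (hr0 : 0 < r)
    (hr1 : r ≤ 1) : (∑ i ∈ s, f i) ^ r ≤ ∑ i ∈ s, f i ^ r :=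
  Finset.le_sum_of_subadditive (fun a : ℝ≥0∞ => a ^ r) (ENNReal.zero_rpow_of_pos hr0).le
    (fun a b => ENNReal.rpow_add_le_add_rpow a b hr0.le hr1) s f

theorem enorm_exp_I_mul_sub_one_le (σ : ℝ) {r : ℝ} (hr0 : 0 < r) (hr1 : r ≤ 1) :
    ‖Complex.exp (Complex.I * σ) - 1‖ₑ ≤ 2 * ‖σ‖ₑ ^ r := by
  rcases le_total ‖σ‖ₑ 1 with h | h
  · calc ‖Complex.exp (Complex.I * σ) - 1‖ₑ ≤ ‖σ‖ₑ ^ (1 : ℝ) := by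
          rw [ENNReal.rpow_one]
          exact Real.enorm_exp_I_mul_ofReal_sub_one_le
      _ ≤ ‖σ‖ₑ ^ r := ENNReal.rpow_le_rpow_of_exponent_ge h hr1
      _ ≤ 2 * ‖σ‖ₑ ^ r := le_mul_of_one_le_left' one_le_two
  · calc ‖Complex.exp (Complex.I * σ) - 1‖ₑ
        ≤ ‖Complex.exp (Complex.I * σ)‖ₑ + ‖(1 : ℂ)‖ₑ := enorm_sub_le
      _ = 2 := by
        rw [← ofReal_norm, mul_comm, Complex.norm_exp_ofReal_mul_I, ENNReal.ofReal_one, enorm_one,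
          one_add_one_eq_two]
      _ ≤ 2 * ‖σ‖ₑ ^ r := le_mul_of_one_le_right' (ENNReal.one_le_rpow h hr0)

section Commutator

variable {d L : ℕ} {r mMin mMax kMax lamMax : ℝ}

theorem enorm_lie_heisenberg_weyl_le {p : Params d} (hm : ∀ x, 0 < p.m x) (h : (h0 p L).PosDef)
    (hr0 : 0 < r) (hr1 : r ≤ 1) (f g : Box d L → ℂ) (t : ℝ) :
    ‖⁅heisenberg p L t (weyl f), weyl g⁆‖ₑ ≤
      2 * ∑ x, ∑ y, (‖rescale (sqrtMass p L) f x‖ₑ * ‖rescale (sqrtMass p L) g y‖ₑ) ^ r *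
        flowSup (hL_isHermitian p L) r x y := by
  rw [weyl_eq_weylL2 f, weyl_eq_weylL2 g, heisenberg_weylL2 hm h]
  refine (enorm_le_iff_norm_le.2 (norm_lie_weylL2_le _ _ _ _)).trans
    ((enorm_exp_I_mul_sub_one_le _ hr0 hr1).trans (mul_le_mul_right ?_ 2))
  refine (ENNReal.rpow_le_rpow (enorm_symplectic_normalModes_le _ _ f g t) hr0.le).trans ?_
  refine (rpow_sum_le_sum_rpow _ _ hr0 hr1).trans (Finset.sum_le_sum fun x _ => ?_)
  refine (rpow_sum_le_sum_rpow _ _ hr0 hr1).trans (Finset.sum_le_sum fun y _ => ?_)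
  refine (rpow_sum_le_sum_rpow _ _ hr0 hr1).trans ?_
  simp only [ENNReal.mul_rpow_of_nonneg _ _ hr0.le, ← Finset.mul_sum]
  gcongr
  exact sum_enorm_spectralKernel_rpow_le_flowSup (hL_isHermitian p L) r t x y

theorem Params.Bounds.iSup_enorm_lie_heisenberg_weyl_le {p : Params d}
    (hp : p.Bounds mMin mMax kMax lamMax) (h : (h0 p L).PosDef) (hr0 : 0 < r) (hr1 : r ≤ 1)
    (f g : Box d L → ℂ) :
    ⨆ t, ‖⁅heisenberg p L t (weyl f), weyl g⁆‖ₑ ≤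
      ∑ x, ∑ y, ENNReal.ofReal (2 * (massBound mMin mMax ^ 2) ^ r * (‖f x‖ ^ r * ‖g y‖ ^ r)) *
        flowSup (hL_isHermitian p L) r x y := by
  have hD := massBound_nonneg mMin mMax
  have hrescale (f : Box d L → ℂ) (x : Box d L) :
      ‖rescale (sqrtMass p L) f x‖ₑ ≤ ENNReal.ofReal (massBound mMin mMax * ‖f x‖) :=
    enorm_rescale_le (sqrtMass_pos hp.m_pos x) (hp.sqrtMass_le x) (hp.inv_sqrtMass_le x) f
  refine iSup_le fun t => (enorm_lie_heisenberg_weyl_le hp.m_pos h hr0 hr1 f g t).trans ?_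
  simp only [Finset.mul_sum, ← mul_assoc (2 : ℝ≥0∞)]
  gcongr with x _ y _
  calc 2 * (‖rescale (sqrtMass p L) f x‖ₑ * ‖rescale (sqrtMass p L) g y‖ₑ) ^ r
      ≤ 2 * (ENNReal.ofReal (massBound mMin mMax * ‖f x‖) *
          ENNReal.ofReal (massBound mMin mMax * ‖g y‖)) ^ r := by
        gcongr
        exacts [hrescale f x, hrescale g y]
    _ = ENNReal.ofReal (2 * (massBound mMin mMax ^ 2 * (‖f x‖ * ‖g y‖)) ^ r) := by
        rw [← ENNReal.ofReal_mul (by positivity), mul_mul_mul_comm, ← pow_two,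
          ENNReal.ofReal_rpow_of_nonneg (by positivity) hr0.le, ENNReal.ofReal_mul two_pos.le,
          ENNReal.ofReal_ofNat]
    _ = _ := by
        rw [Real.mul_rpow (by positivity) (by positivity), Real.mul_rpow (by positivity)
          (by positivity), mul_assoc]

variable {Ω : Type*} [MeasurableSpace Ω] {P : Measure Ω} {p : Ω → Params d}

/-- The sum over sites is taken out of the integral while its terms are the measurable functions
`flowSup`: lower integrals of the correlators themselves need not be additive. -/
theorem lintegral_iSup_lie_heisenberg_weyl_le (hm : ∀ x, Measurable fun ω => (p ω).m x)
    (hk : ∀ x, Measurable fun ω => (p ω).k x)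
    (hlam : ∀ x y, siteDist x y = 1 → Measurable fun ω => (p ω).lam s(x, y))
    (hbounds : ∀ᵐ ω ∂P, (p ω).Bounds mMin mMax kMax lamMax)
    (hpos : ∀ᵐ ω ∂P, (h0 (p ω) L).PosDef) (hr0 : 0 < r) (hr1 : r ≤ 1) (f g : Box d L → ℂ) :
    ∫⁻ ω, ⨆ t : ℝ, ‖⁅heisenberg (p ω) L t (weyl f), weyl g⁆‖ₑ ∂P ≤
      ∑ x, ∑ y, ENNReal.ofReal (2 * (massBound mMin mMax ^ 2) ^ r * (‖f x‖ ^ r * ‖g y‖ ^ r)) *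
        (3 * ENNReal.ofReal ((1 + eigenBound d mMin mMax kMax lamMax) ^ r) *
          ∫⁻ ω, eigenCorrelator (-1 / 2) r (p ω) L x y ∂P) := by
  have hposL : ∀ᵐ ω ∂P, (hL (p ω) L).PosDef := by
    filter_upwards [hbounds, hpos] with ω hω hω'
    exact hL_posDef hω.m_pos hω'
  have hmeas (x y : Box d L) : AEMeasurable (fun ω => flowSup (hL_isHermitian (p ω) L) r x y) P :=
    aemeasurable_flowSup (fun ω => hL_isHermitian (p ω) L) (measurable_hL hm hk hlam) hposL r x y
  calc _ ≤ ∫⁻ ω, ∑ x, ∑ y, ENNReal.ofReal (2 * (massBound mMin mMax ^ 2) ^ r *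
          (‖f x‖ ^ r * ‖g y‖ ^ r)) * flowSup (hL_isHermitian (p ω) L) r x y ∂P := by
        refine lintegral_mono_ae ?_
        filter_upwards [hbounds, hpos] with ω hω hω'
        exact hω.iSup_enorm_lie_heisenberg_weyl_le hω' hr0 hr1 f g
    _ = ∑ x, ∑ y, ENNReal.ofReal (2 * (massBound mMin mMax ^ 2) ^ r * (‖f x‖ ^ r * ‖g y‖ ^ r)) *
          ∫⁻ ω, flowSup (hL_isHermitian (p ω) L) r x y ∂P := by
        rw [lintegral_finsetSum' _ fun x _ =>
          Finset.aemeasurable_fun_sum _ fun y _ => (hmeas x y).const_mul _]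
        refine Finset.sum_congr rfl fun x _ => ?_
        rw [lintegral_finsetSum' _ fun y _ => (hmeas x y).const_mul _]
        exact Finset.sum_congr rfl fun y _ => lintegral_const_mul'' _ (hmeas x y)
    _ ≤ _ := by
        gcongr with x _ y _
        rw [← lintegral_const_mul' _ _ (by finiteness)]
        refine lintegral_mono_ae ?_
        filter_upwards [hbounds, hpos] with ω hω hω'
        exact hω.flowSup_le hω' hr0.le x y

end Commutator

end OscillatorSystem

end

theorem theorem3p3_general {d : ℕ} {Ω : Type*} [MeasurableSpace Ω] (P : Measure Ω)
    (p : Ω → Params d)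
    (hm_meas : ∀ x, Measurable fun ω => (p ω).m x)
    (hk_meas : ∀ x, Measurable fun ω => (p ω).k x)
    (hlam_meas : ∀ x y, siteDist x y = 1 → Measurable fun ω => (p ω).lam s(x, y))
    {mMin mMax kMax lamMax : ℝ}
    (hA1 : ∀ᵐ ω ∂P, (p ω).Bounds mMin mMax kMax lamMax)
    (hA2 : ∀ᵐ ω ∂P, ∀ L : ℕ, 1 ≤ L → (h0 (p ω) L).PosDef)
    {r : ℝ} (hr0 : 0 < r) (hr1 : r ≤ 1)
    (hcorr : ExpDecayingCorrelators P p (-1 / 2) r) :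
    ∃ C' μ' : ℝ, 0 < μ' ∧ ∀ L : ℕ, 1 ≤ L → ∀ f g : Box d L → ℂ,
      ∫⁻ ω, ⨆ t : ℝ, ‖⁅heisenberg (p ω) L t (weyl f), weyl g⁆‖ₑ ∂P
        ≤ ENNReal.ofReal (C' * ∑ x : Box d L, ∑ y : Box d L,
            ‖f x‖ ^ r * ‖g y‖ ^ r * Real.exp (-μ' * siteDist (x : Site d) y)) := by
  obtain ⟨C, μ, hμ, hC⟩ := hcorr
  have hB : 0 ≤ 1 + eigenBound d mMin mMax kMax lamMax := add_nonneg zero_le_one eigenBound_nonneg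
  refine ⟨6 * (massBound mMin mMax ^ 2) ^ r * (1 + eigenBound d mMin mMax kMax lamMax) ^ r * |C|,
    μ, hμ, fun L hL f g => ?_⟩
  have hcorrelator (x y : Box d L) : ∫⁻ ω, eigenCorrelator (-1 / 2) r (p ω) L x y ∂P ≤
      ENNReal.ofReal (|C| * Real.exp (-μ * siteDist (x : Site d) y)) :=
    (hC L hL x y).trans (by gcongr; exact le_abs_self C)
  refine (lintegral_iSup_lie_heisenberg_weyl_le hm_meas hk_meas hlam_meas hA1
    (hA2.mono fun ω h => h L hL) hr0 hr1 f g).trans ?_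
  simp only [Finset.mul_sum]
  rw [ENNReal.ofReal_sum_of_nonneg fun x _ => by positivity]
  refine Finset.sum_le_sum fun x _ => ?_
  rw [ENNReal.ofReal_sum_of_nonneg fun y _ => by positivity]
  refine Finset.sum_le_sum fun y _ => ?_
  refine (mul_le_mul_right (mul_le_mul_right (hcorrelator x y) _) _).trans_eq ?_
  rw [← ENNReal.ofReal_ofNat, ← ENNReal.ofReal_mul (by positivity),
    ← ENNReal.ofReal_mul (by positivity), ← ENNReal.ofReal_mul (by positivity)]
  congr 1
  ring

theorem theorem3p3 {d : ℕ} (hd : 1 ≤ d) {Ω : Type*} [MeasurableSpace Ω]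
    (P : Measure Ω) [IsProbabilityMeasure P] (p : Ω → Params d)
    (hm_meas : ∀ x, Measurable fun ω => (p ω).m x)
    (hk_meas : ∀ x, Measurable fun ω => (p ω).k x)
    (hlam_meas : ∀ x y, siteDist x y = 1 → Measurable fun ω => (p ω).lam s(x, y))
    {mMin mMax kMax lamMax : ℝ}
    (hA1 : ∀ᵐ ω ∂P, (p ω).Bounds mMin mMax kMax lamMax)
    (hA2 : ∀ᵐ ω ∂P, ∀ L : ℕ, 1 ≤ L → (h0 (p ω) L).PosDef)
    {r : ℝ} (hr0 : 0 < r) (hr1 : r ≤ 1)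
    (hcorr : ExpDecayingCorrelators P p (-1 / 2) r) :
    ∃ C' μ' : ℝ, 0 < μ' ∧ ∀ L : ℕ, 1 ≤ L → ∀ f g : Box d L → ℂ,
      ∫⁻ ω, ⨆ t : ℝ, ‖⁅heisenberg (p ω) L t (weyl f), weyl g⁆‖ₑ ∂P
        ≤ ENNReal.ofReal (C' * ∑ x : Box d L, ∑ y : Box d L,
            ‖f x‖ ^ r * ‖g y‖ ^ r * Real.exp (-μ' * siteDist (x : Site d) y)) :=
  theorem3p3_general P p hm_meas hk_meas hlam_meas hA1 hA2 hr0 hr1 hcorr
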